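/- Work in second order arithmetic; $\mathbb N$ denotes the first order part of the model under consideration. A graph is a pair $G=(V,E)$ with $V\subseteq\mathbb N$ nonempty and $E$ an irreflexive, symmetric relation on $V$. Finite sets are bounded sets, and cardinalities are given by bijections with $\{0,\dots,n-1\}$ in the model. For $n\in\mathbb N$, an $n$-extension pair in $G$ is a pair $\langle X_0,X_1\rangle$ of disjoint finite subsets of $V$ with $|X_0|+|X_1|=n$. The extension property holds for $\langle X_0,X_1\rangle$ in $G$ if there is a vertex $v\in V\setminus(X_0\cup X_1)$ that is connected to every vertex in $X_0$ and to no vertex in $X_1$. A random graph is a graph in which the extension property holds for every pair of disjoint finite sets of vertices; $\mathsf{RCA}_0$ proves that such a graph exists and is unique up to isomorphism, and $\mathcal R$ denotes a random graph. **Theorem 5.1.** The following are equivalent over $\mathsf{RCA}_0$ (that is, in every model of $\mathsf{RCA}_0$ one holds if and only if the other does): 1. For every graph $G$ not isomorphic to $\mathcal R$, there is a least $n$ for which there is an $n$-extension pair $\langle X_0,X_1\rangle$ in $G$ that fails to have the extension property. 2. $\mathsf{L}\Sigma^0_2$: for every $\Sigma^0_2$ formula $\varphi(n)$ (number and set parameters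 allowed), if some $n$ satisfies $\varphi(n)$, then there is a least such $n$. -/

import Mathlib

universe u

namespace SecondOrderArith

/-! ## Second order arithmetic: structures, formulas, and the system `RCA₀` -/

/-- A structure for the language of second order arithmetic: a first order part `Carrier` with
`0, 1, +, ·, <`, and a nonempty collection `sets` of subsets of it, over which the set variables
range. Equality is true equality, and sets are extensional. -/
structure Structure2 where
  Carrier : Type u
  [zero : Zero Carrier]
  [one : One Carrier]
  [add : Add Carrier]
  [mul : Mul Carrier]
  [lt : LT Carrier]
  sets : Set (Set Carrier)
  sets_nonempty : sets.Nonempty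

attribute [instance] Structure2.zero Structure2.one Structure2.add Structure2.mul Structure2.lt

/-- Numerical terms; `var i` is the `i`-th number variable (de Bruijn index). -/
inductive NumTerm : Type
  | var (i : ℕ) : NumTerm
  | zero : NumTerm
  | one : NumTerm
  | add (s t : NumTerm) : NumTerm
  | mul (s t : NumTerm) : NumTerm

/-- Bounded quantifier formulas (`Σ⁰₀` formulas) of second order arithmetic, with free number
variables and free set variables. `ball t φ` is `∀ x < t, φ`: it binds the number variable `0` of
`φ` and shifts the others by one, so that `t` cannot contain `x`. The other connectives and the
bounded existential quantifier are classical abbreviations. -/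
inductive BddFormula : Type
  | eq (s t : NumTerm) : BddFormula
  | lt (s t : NumTerm) : BddFormula
  | mem (t : NumTerm) (X : ℕ) : BddFormula
  | not (φ : BddFormula) : BddFormula
  | and (φ ψ : BddFormula) : BddFormula
  | ball (t : NumTerm) (φ : BddFormula) : BddFormula

/-- The assignment `a, v 0, v 1, …`. -/
def push {α : Type u} (a : α) (v : ℕ → α) : ℕ → α
  | 0 => a
  | i + 1 => v i

namespace Structure2

variable (M : Structure2.{u})

/-- The value of a term under an assignment `v` of the number variables. -/
def eval (v : ℕ → M.Carrier) : NumTerm → M.Carrier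
  | .var i => v i
  | .zero => 0
  | .one => 1
  | .add s t => eval v s + eval v t
  | .mul s t => eval v s * eval v t

/-- Truth of a bounded quantifier formula under assignments `W` of the set variables and `v` of the
number variables. -/
def Realize (W : ℕ → Set M.Carrier) : (ℕ → M.Carrier) → BddFormula → Prop
  | v, .eq s t => M.eval v s = M.eval v t
  | v, .lt s t => M.eval v s < M.eval v t
  | v, .mem t X => M.eval v t ∈ W X
  | v, .not φ => ¬ Realize W v φ
  | v, .and φ ψ => Realize W v φ ∧ Realize W v ψ
  | v, .ball t φ => ∀ a : M.Carrier, a < M.eval v t → Realize W (push a v) φ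

/-- `P` is defined in `M` by a `Σ⁰₁` formula `∃ x θ(x, n)`, `θ` a bounded quantifier formula,
with number parameters and set parameters from `M`. -/
def IsSigma1 (P : M.Carrier → Prop) : Prop :=
  ∃ (θ : BddFormula) (W : ℕ → Set M.Carrier) (v : ℕ → M.Carrier), (∀ i, W i ∈ M.sets) ∧
    ∀ n, P n ↔ ∃ x, M.Realize W (push x (push n v)) θ

/-- `P` is defined in `M` by a `Π⁰₁` formula `∀ x θ(x, n)` with parameters from `M`. -/
def IsPi1 (P : M.Carrier → Prop) : Prop :=
  ∃ (θ : BddFormula) (W : ℕ → Set M.Carrier) (v : ℕ → M.Carrier), (∀ i, W i ∈ M.sets) ∧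
    ∀ n, P n ↔ ∀ x, M.Realize W (push x (push n v)) θ

/-- `P` is defined in `M` by a `Σ⁰₂` formula `∃ x ∀ y θ(y, x, n)` with parameters from `M`. -/
def IsSigma2 (P : M.Carrier → Prop) : Prop :=
  ∃ (θ : BddFormula) (W : ℕ → Set M.Carrier) (v : ℕ → M.Carrier), (∀ i, W i ∈ M.sets) ∧
    ∀ n, P n ↔ ∃ x, ∀ y, M.Realize W (push y (push x (push n v))) θ

/-- `M` is a model of `RCA₀`: the basic axioms of arithmetic, induction for `Σ⁰₁` formulas, and
comprehension for `Δ⁰₁` formulas. -/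
structure ModelsRCA0 : Prop where
  add_one_ne_zero : ∀ n : M.Carrier, n + 1 ≠ 0
  add_one_inj : ∀ m n : M.Carrier, m + 1 = n + 1 → m = n
  add_zero : ∀ m : M.Carrier, m + 0 = m
  add_add_one : ∀ m n : M.Carrier, m + (n + 1) = (m + n) + 1
  mul_zero : ∀ m : M.Carrier, m * 0 = 0
  mul_add_one : ∀ m n : M.Carrier, m * (n + 1) = m * n + m
  not_lt_zero : ∀ m : M.Carrier, ¬ m < 0
  lt_add_one_iff : ∀ m n : M.Carrier, m < n + 1 ↔ m < n ∨ m = n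
  sigma1_induction : ∀ P : M.Carrier → Prop, M.IsSigma1 P →
    P 0 → (∀ n, P n → P (n + 1)) → ∀ n, P n
  delta1_comprehension : ∀ P : M.Carrier → Prop, M.IsSigma1 P → M.IsPi1 P →
    {n | P n} ∈ M.sets

/-- The least number principle `LΣ⁰₂` holds in `M`. -/
def LeastSigma2 : Prop :=
  ∀ P : M.Carrier → Prop, M.IsSigma2 P →
    (∃ n, P n) → ∃ n, P n ∧ ∀ m, m < n → ¬ P m

/-! ## Finite sets, functions and graphs inside a structure

All quantifiers below range over the first order part or over the sets of `M`, so that each of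
these notions is the truth in `M` of a formula of second order arithmetic. -/

variable {M}

/-- The code `(i + j)² + i` of the ordered pair `(i, j)`. -/
def pair (i j : M.Carrier) : M.Carrier := (i + j) * (i + j) + i

/-- `f`, as a set of codes of pairs, is (the graph of) a bijection from `X` onto `Y`. -/
def IsBijection (f X Y : Set M.Carrier) : Prop :=
  (∀ e ∈ f, ∃ x ∈ X, ∃ y ∈ Y, e = pair x y) ∧
  (∀ x ∈ X, ∃! y, pair x y ∈ f) ∧
  (∀ y ∈ Y, ∃! x, pair x y ∈ f)

/-- Finiteness in the sense of `M`: the set is bounded. -/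
def IsFinite (X : Set M.Carrier) : Prop := ∃ k, ∀ x ∈ X, x < k

/-- `|X| = n` in the sense of `M`: `X` is finite and some set of `M` is a bijection from `X`
onto `{0, …, n - 1}`. -/
def HasCard (X : Set M.Carrier) (n : M.Carrier) : Prop :=
  IsFinite X ∧ ∃ f ∈ M.sets, IsBijection f X {i | i < n}

variable (M)

/-- A graph in `M`: a nonempty set of vertices and an irreflexive symmetric edge relation on it,
both sets of `M`. -/
structure Graph where
  V : Set M.Carrier
  E : Set M.Carrier
  V_mem : V ∈ M.sets
  E_mem : E ∈ M.sets
  nonempty : V.Nonempty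
  E_sub : ∀ e ∈ E, ∃ x ∈ V, ∃ y ∈ V, e = pair x y
  irrefl : ∀ x, pair x x ∉ E
  symm : ∀ x y, pair x y ∈ E → pair y x ∈ E

variable {M}

namespace Graph

/-- Adjacency. -/
def Adj (G : M.Graph) (x y : M.Carrier) : Prop := pair x y ∈ G.E

/-- `G` and `H` are isomorphic in `M`: some set of `M` is an isomorphism. -/
def Iso (G H : M.Graph) : Prop :=
  ∃ f ∈ M.sets, IsBijection f G.V H.V ∧
    ∀ x x' y y', pair x y ∈ f → pair x' y' ∈ f → (G.Adj x x' ↔ H.Adj y y')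

/-- The extension property for `⟨A, B⟩` in `G`: some vertex outside `A ∪ B` is connected to every
vertex in `A` and to none in `B`. -/
def HasExtension (G : M.Graph) (A B : Set M.Carrier) : Prop :=
  ∃ x ∈ G.V, x ∉ A ∪ B ∧ (∀ a ∈ A, G.Adj x a) ∧ (∀ b ∈ B, ¬ G.Adj x b)

/-- `G` is a random graph in `M`: it satisfies the extension axiom, which says that the extension
property holds for all disjoint finite sets `A, B` of vertices. -/
def IsRandom (G : M.Graph) : Prop :=
  ∀ A ∈ M.sets, ∀ B ∈ M.sets, IsFinite A → IsFinite B → A ⊆ G.V → B ⊆ G.V → Disjoint A B →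
    G.HasExtension A B

/-- `⟨A, B⟩` is an `n`-extension pair in `G`: `A` and `B` are disjoint finite sets of vertices
with `|A| + |B| = n`. -/
def IsExtensionPair (G : M.Graph) (n : M.Carrier) (A B : Set M.Carrier) : Prop :=
  A ∈ M.sets ∧ B ∈ M.sets ∧ A ⊆ G.V ∧ B ⊆ G.V ∧ Disjoint A B ∧
    ∃ a b, HasCard A a ∧ HasCard B b ∧ a + b = n

/-- Some `n`-extension pair in `G` fails to have the extension property. -/
def ExtensionFails (G : M.Graph) (n : M.Carrier) : Prop :=
  ∃ A B, G.IsExtensionPair n A B ∧ ¬ G.HasExtension A B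

end Graph

variable (M)

/-- The statement, in `M`: for every graph `G` not isomorphic to the random graph `R`, there is a
least `n` for which some `n`-extension pair in `G` fails to have the extension property. Here `R`
is any random graph of `M`. -/
def LeastExtensionFailure : Prop :=
  ∀ R : M.Graph, R.IsRandom → ∀ G : M.Graph, ¬ G.Iso R →
    ∃ n, G.ExtensionFails n ∧ ∀ m, m < n → ¬ G.ExtensionFails m

end Structure2

end SecondOrderArith

/-! Finite sets have numerical codes, so statements about finite sets become statements about
numbers; both implications rest on this.

From `LeastSigma2` to least failures: a failing pair of size n is given by codes of its two sides
and of bijections counting them, such that no vertex is a witness. In terms of codes everything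
after one leading ∃ and one ∀ is bounded, so `ExtensionFails` is Σ⁰₂ (`isSigma2_extensionFails`).
Some size fails, because a graph not isomorphic to the random graph R is not random: any two random
graphs are isomorphic by back-and-forth (`IsRandom.iso`), and every finite set has a cardinality
(`exists_hasCard`).

Conversely, let P(m) be ∃x ∀y Q(m, x, y). In `blockGraph` each (m, x) owns a block of m + 1 even
vertices. An odd vertex z = 2w + 1 is joined to the members of the finite set coded by w, all of
them smaller than z, provided every block inside that set with m, x ≤ z has a counterexample y < z
to Q. There are no other edges. If Q(m, x, y) holds for all y, the block of (m, x) has no common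
neighbour, so size m + 1 fails (`blockGraph_extensionFails`). If every block inside A has a
counterexample, collection bounds these, and a large code of A gives a witness for ⟨A, B⟩
(`blockGraph_hasExtension`). Hence a failure of size n has a block with P(m) inside its first side,
and m + 1 ≤ n by the pigeonhole principle. The least failing size is therefore one more than the
least m with P(m). Taking Q false gives a random graph, and randomness is invariant under
isomorphism, so a block graph with a failure is not isomorphic to R.

All of this takes place inside a model with only Σ⁰₁ induction and Δ⁰₁ comprehension. Arithmetic,
collection, Π⁰₁ induction, coding and recursion are derived from these. Definability is treated
semantically through `Delta0`, which is translated to formulas once and for all. -/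

namespace SecondOrderArith

/-! ## Definability by bounded quantifier formulas -/

namespace NumTerm

/-- Renaming of the variables of a term. -/
def rename (f : ℕ → ℕ) : NumTerm → NumTerm
  | .var i => .var (f i)
  | .zero => .zero
  | .one => .one
  | .add s t => .add (s.rename f) (t.rename f)
  | .mul s t => .mul (s.rename f) (t.rename f)

end NumTerm

/-- A renaming under a quantifier. -/
def liftRename (f : ℕ → ℕ) : ℕ → ℕ
  | 0 => 0
  | i + 1 => f i + 1

namespace BddFormula

/-- Renaming of the number variables and the set variables of a formula. -/
def rename (g : ℕ → ℕ) : (ℕ → ℕ) → BddFormula → BddFormula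
  | f, .eq s t => .eq (s.rename f) (t.rename f)
  | f, .lt s t => .lt (s.rename f) (t.rename f)
  | f, .mem t X => .mem (t.rename f) (g X)
  | f, .not φ => .not (φ.rename g f)
  | f, .and φ ψ => .and (φ.rename g f) (ψ.rename g f)
  | f, .ball t φ => .ball (t.rename f) (φ.rename g (liftRename f))

end BddFormula

namespace Structure2

variable {M : Structure2.{u}}

theorem eval_rename (f : ℕ → ℕ) (v : ℕ → M.Carrier) (t : NumTerm) :
    M.eval v (t.rename f) = M.eval (v ∘ f) t := by
  induction t with
  | var i => rfl
  | zero => rfl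
  | one => rfl
  | add s t hs ht => simp [NumTerm.rename, eval, hs, ht]
  | mul s t hs ht => simp [NumTerm.rename, eval, hs, ht]

theorem push_comp_liftRename (f : ℕ → ℕ) (a : M.Carrier) (v : ℕ → M.Carrier) :
    push a v ∘ liftRename f = push a (v ∘ f) := by
  funext i; cases i <;> rfl

theorem realize_rename (W : ℕ → Set M.Carrier) (g : ℕ → ℕ) (φ : BddFormula) :
    ∀ (f : ℕ → ℕ) (v : ℕ → M.Carrier),
      M.Realize W v (φ.rename g f) ↔ M.Realize (W ∘ g) (v ∘ f) φ := by
  induction φ with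
  | eq s t => intro f v; simp [BddFormula.rename, Realize, eval_rename]
  | lt s t => intro f v; simp [BddFormula.rename, Realize, eval_rename]
  | mem t X => intro f v; simp [BddFormula.rename, Realize, eval_rename]
  | not φ h => intro f v; simp [BddFormula.rename, Realize, h]
  | and φ ψ h₁ h₂ => intro f v; simp [BddFormula.rename, Realize, h₁, h₂]
  | ball t φ h =>
    intro f v; simp [BddFormula.rename, Realize, h, eval_rename, push_comp_liftRename]

/-- The functions of an assignment given by terms with number parameters. -/
inductive IsTerm : ((ℕ → M.Carrier) → M.Carrier) → Prop
  | var (i : ℕ) : IsTerm fun v => v i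
  | const (c : M.Carrier) : IsTerm fun _ => c
  | add {s t : (ℕ → M.Carrier) → M.Carrier} :
      IsTerm s → IsTerm t → IsTerm fun v => s v + t v
  | mul {s t : (ℕ → M.Carrier) → M.Carrier} :
      IsTerm s → IsTerm t → IsTerm fun v => s v * t v

/-- The relations on assignments defined by bounded quantifier formulas with parameters. -/
inductive Delta0 : ((ℕ → M.Carrier) → Prop) → Prop
  | eq {s t : (ℕ → M.Carrier) → M.Carrier} :
      IsTerm s → IsTerm t → Delta0 fun v => s v = t v
  | lt {s t : (ℕ → M.Carrier) → M.Carrier} :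
      IsTerm s → IsTerm t → Delta0 fun v => s v < t v
  | mem {t : (ℕ → M.Carrier) → M.Carrier} {X : Set M.Carrier} :
      X ∈ M.sets → IsTerm t → Delta0 fun v => t v ∈ X
  | not {P : (ℕ → M.Carrier) → Prop} : Delta0 P → Delta0 fun v => ¬ P v
  | and {P Q : (ℕ → M.Carrier) → Prop} : Delta0 P → Delta0 Q → Delta0 fun v => P v ∧ Q v
  | ball_push {t : (ℕ → M.Carrier) → M.Carrier} {P : (ℕ → M.Carrier) → Prop} :
      IsTerm t → Delta0 P → Delta0 fun v => ∀ a, a < t v → P (push a v)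

/-- The assignment of the variables of a formula to variables of the context or parameters. -/
def look (ρ : ℕ → ℕ ⊕ M.Carrier) (v : ℕ → M.Carrier) : ℕ → M.Carrier :=
  fun i => (ρ i).elim v id

/-- Interleaving of two sequences. -/
def interleave {α : Type*} (a b : ℕ → α) : ℕ → α :=
  fun i => if i % 2 = 0 then a (i / 2) else b (i / 2)

theorem interleave_even {α : Type*} (a b : ℕ → α) (i : ℕ) : interleave a b (2 * i) = a i := by
  simp [interleave]

theorem interleave_odd {α : Type*} (a b : ℕ → α) (i : ℕ) :
    interleave a b (2 * i + 1) = b i := by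
  have h₁ : (2 * i + 1) % 2 = 1 := by omega
  have h₂ : (2 * i + 1) / 2 = i := by omega
  simp [interleave, h₁, h₂]

theorem look_interleave_even (ρ σ : ℕ → ℕ ⊕ M.Carrier) (v : ℕ → M.Carrier) :
    look (interleave ρ σ) v ∘ (fun i => 2 * i) = look ρ v := by
  funext i; simp [look, interleave_even]

theorem look_interleave_odd (ρ σ : ℕ → ℕ ⊕ M.Carrier) (v : ℕ → M.Carrier) :
    look (interleave ρ σ) v ∘ (fun i => 2 * i + 1) = look σ v := by
  funext i; simp [look, interleave_odd]

theorem IsTerm.exists_term {t : (ℕ → M.Carrier) → M.Carrier} (h : IsTerm t) :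
    ∃ (s : NumTerm) (ρ : ℕ → ℕ ⊕ M.Carrier), ∀ v, t v = M.eval (look ρ v) s := by
  induction h with
  | var i => exact ⟨.var 0, fun _ => .inl i, fun v => rfl⟩
  | const c => exact ⟨.var 0, fun _ => .inr c, fun v => rfl⟩
  | add _ _ h₁ h₂ =>
    obtain ⟨s, ρ, hs⟩ := h₁
    obtain ⟨t, σ, ht⟩ := h₂
    refine ⟨.add (s.rename fun i => 2 * i) (t.rename fun i => 2 * i + 1), interleave ρ σ,
      fun v => ?_⟩
    simp [eval, eval_rename, look_interleave_even, look_interleave_odd, hs, ht]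
  | mul _ _ h₁ h₂ =>
    obtain ⟨s, ρ, hs⟩ := h₁
    obtain ⟨t, σ, ht⟩ := h₂
    refine ⟨.mul (s.rename fun i => 2 * i) (t.rename fun i => 2 * i + 1), interleave ρ σ,
      fun v => ?_⟩
    simp [eval, eval_rename, look_interleave_even, look_interleave_odd, hs, ht]

theorem interleave_mem {W₁ W₂ : ℕ → Set M.Carrier} (h₁ : ∀ i, W₁ i ∈ M.sets)
    (h₂ : ∀ i, W₂ i ∈ M.sets) (i : ℕ) : interleave W₁ W₂ i ∈ M.sets := by
  unfold interleave; split_ifs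
  exacts [h₁ _, h₂ _]

theorem interleave_comp_even {α : Type*} (a b : ℕ → α) :
    interleave a b ∘ (fun i => 2 * i) = a := by
  funext i; simp [interleave_even]

theorem interleave_comp_odd {α : Type*} (a b : ℕ → α) :
    interleave a b ∘ (fun i => 2 * i + 1) = b := by
  funext i; simp [interleave_odd]

/-- Every `Delta0` relation is defined by a bounded quantifier formula. -/
theorem Delta0.exists_formula {P : (ℕ → M.Carrier) → Prop} (h : Delta0 P) :
    ∃ (θ : BddFormula) (W : ℕ → Set M.Carrier) (ρ : ℕ → ℕ ⊕ M.Carrier),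
      (∀ i, W i ∈ M.sets) ∧ ∀ v, P v ↔ M.Realize W (look ρ v) θ := by
  obtain ⟨X₀, hX₀⟩ := M.sets_nonempty
  induction h with
  | eq h₁ h₂ =>
    obtain ⟨s, ρ, hs⟩ := h₁.exists_term
    obtain ⟨t, σ, ht⟩ := h₂.exists_term
    refine ⟨.eq (s.rename fun i => 2 * i) (t.rename fun i => 2 * i + 1), fun _ => X₀,
      interleave ρ σ, fun _ => hX₀, fun v => ?_⟩
    simp [Realize, eval_rename, look_interleave_even, look_interleave_odd, hs, ht]
  | lt h₁ h₂ =>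
    obtain ⟨s, ρ, hs⟩ := h₁.exists_term
    obtain ⟨t, σ, ht⟩ := h₂.exists_term
    refine ⟨.lt (s.rename fun i => 2 * i) (t.rename fun i => 2 * i + 1), fun _ => X₀,
      interleave ρ σ, fun _ => hX₀, fun v => ?_⟩
    simp [Realize, eval_rename, look_interleave_even, look_interleave_odd, hs, ht]
  | @mem t X hX h =>
    obtain ⟨s, ρ, hs⟩ := h.exists_term
    exact ⟨.mem s 0, fun _ => X, ρ, fun _ => hX, fun v => by simp [Realize, hs]⟩
  | not _ ih =>
    obtain ⟨θ, W, ρ, hW, h⟩ := ih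
    exact ⟨.not θ, W, ρ, hW, fun v => by simp [Realize, h]⟩
  | and _ _ ih₁ ih₂ =>
    obtain ⟨θ₁, W₁, ρ₁, hW₁, h₁⟩ := ih₁
    obtain ⟨θ₂, W₂, ρ₂, hW₂, h₂⟩ := ih₂
    -- The two formulas come with unrelated lists of parameters; even and odd slots keep them apart.
    refine ⟨.and (θ₁.rename (fun i => 2 * i) fun i => 2 * i)
      (θ₂.rename (fun i => 2 * i + 1) fun i => 2 * i + 1), interleave W₁ W₂, interleave ρ₁ ρ₂,
      interleave_mem hW₁ hW₂, fun v => ?_⟩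
    simp [Realize, realize_rename, look_interleave_even, look_interleave_odd, h₁, h₂,
      interleave_comp_even, interleave_comp_odd]
  | ball_push ht _ ih =>
    obtain ⟨s, σ, hs⟩ := ht.exists_term
    obtain ⟨θ, W, ρ, hW, h⟩ := ih
    -- A slot reading the bound variable goes to index 0. Every other slot `i` goes to the odd slot
    -- `2 * i + 1`, raised by one for the quantifier, and a context variable read there loses one
    -- from its index.
    refine ⟨.ball (s.rename fun i => 2 * i)
      (θ.rename id fun i => (ρ i).elim (fun j => if j = 0 then 0 else 2 * i + 1 + 1)
        fun _ => 2 * i + 1 + 1), W,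
      interleave σ fun i => (ρ i).map (fun j => j - 1) id, hW, fun v => ?_⟩
    simp only [Realize, eval_rename, look_interleave_even, hs, realize_rename, h,
      Function.comp_id]
    refine forall_congr' fun a => imp_congr_right fun _ => ?_
    suffices H : look ρ (push a v) =
        push a (look (interleave σ fun i => (ρ i).map (fun j => j - 1) id) v) ∘
          fun i => (ρ i).elim (fun j => if j = 0 then 0 else 2 * i + 1 + 1)
            fun _ => 2 * i + 1 + 1 by rw [H]
    funext i
    rcases hi : ρ i with j | c
    · rcases j with _ | j
      · simp [look, hi, push]
      · simp [look, hi, push, interleave_odd]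
    · simp [look, hi, push, interleave_odd]

theorem IsTerm.subst {s : (ℕ → M.Carrier) → M.Carrier} (hs : IsTerm s)
    {t : ℕ → (ℕ → M.Carrier) → M.Carrier} (ht : ∀ i, IsTerm (t i)) :
    IsTerm fun v => s fun i => t i v := by
  induction hs with
  | var i => exact ht i
  | const c => exact .const c
  | add _ _ h₁ h₂ => exact .add h₁ h₂
  | mul _ _ h₁ h₂ => exact .mul h₁ h₂

theorem IsTerm.rename {s : (ℕ → M.Carrier) → M.Carrier} (hs : IsTerm s) (f : ℕ → ℕ) :
    IsTerm fun v => s fun i => v (f i) :=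
  hs.subst fun i => .var (f i)

theorem IsTerm.pair {s t : (ℕ → M.Carrier) → M.Carrier} (hs : IsTerm s) (ht : IsTerm t) :
    IsTerm fun v => Structure2.pair (s v) (t v) :=
  .add (.mul (.add hs ht) (.add hs ht)) hs

/-! ### Closure properties of bounded definability -/

namespace Delta0

theorem congr {P Q : (ℕ → M.Carrier) → Prop} (hQ : Delta0 Q) (h : ∀ v, P v ↔ Q v) :
    Delta0 P := by
  have : P = Q := funext fun v => propext (h v)
  rwa [this]

theorem subst {P : (ℕ → M.Carrier) → Prop} (hP : Delta0 P) :
    ∀ {t : ℕ → (ℕ → M.Carrier) → M.Carrier}, (∀ i, IsTerm (t i)) →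
      Delta0 fun v => P fun i => t i v := by
  induction hP with
  | eq h₁ h₂ => exact fun ht => .eq (h₁.subst ht) (h₂.subst ht)
  | lt h₁ h₂ => exact fun ht => .lt (h₁.subst ht) (h₂.subst ht)
  | mem hX h => exact fun ht => .mem hX (h.subst ht)
  | not _ h => exact fun ht => .not (h ht)
  | and _ _ h₁ h₂ => exact fun ht => .and (h₁ ht) (h₂ ht)
  | @ball_push s P hs _ ih =>
    intro t ht
    -- Substitution under the quantifier: variable 0 is kept, and the substituted terms read the
    -- assignment shifted by one. The `Nat.rec` is only a case split.
    have key : Delta0 fun w : ℕ → M.Carrier => P fun i =>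
        (fun (i : ℕ) (w : ℕ → M.Carrier) =>
          Nat.rec (motive := fun _ => M.Carrier) (w 0) (fun k _ => t k fun j => w (j + 1)) i) i w := by
      refine ih fun i => ?_
      cases i with
      | zero => exact .var 0
      | succ k => exact (ht k).rename fun j => j + 1
    refine congr (.ball_push (hs.subst ht) key) fun v => ?_
    refine forall_congr' fun a => imp_congr_right fun _ => ?_
    suffices H : push a (fun i => t i v) = fun i =>
        Nat.rec (motive := fun _ => M.Carrier) (push a v 0)
          (fun k _ => t k fun j => push a v (j + 1)) i by rw [H]
    funext i; cases i <;> rfl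

theorem rename {P : (ℕ → M.Carrier) → Prop} (hP : Delta0 P) (f : ℕ → ℕ) :
    Delta0 fun v => P fun i => v (f i) :=
  hP.subst fun i => .var (f i)

theorem ball {t : (ℕ → M.Carrier) → M.Carrier} {P : M.Carrier → (ℕ → M.Carrier) → Prop}
    (ht : IsTerm t) (hP : Delta0 fun w => P (w 0) fun i => w (i + 1)) :
    Delta0 fun v => ∀ a, a < t v → P a v :=
  .ball_push ht hP

theorem bex {t : (ℕ → M.Carrier) → M.Carrier} {P : M.Carrier → (ℕ → M.Carrier) → Prop}
    (ht : IsTerm t) (hP : Delta0 fun w => P (w 0) fun i => w (i + 1)) :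
    Delta0 fun v => ∃ a, a < t v ∧ P a v :=
  congr (.not (ball (P := fun a v => ¬ P a v) ht (.not hP))) fun v => by simp

theorem or {P Q : (ℕ → M.Carrier) → Prop} (hP : Delta0 P) (hQ : Delta0 Q) :
    Delta0 fun v => P v ∨ Q v :=
  congr (.not (.and (.not hP) (.not hQ))) fun v => by tauto

theorem imp {P Q : (ℕ → M.Carrier) → Prop} (hP : Delta0 P) (hQ : Delta0 Q) :
    Delta0 fun v => P v → Q v :=
  congr (.or (.not hP) hQ) fun v => by tauto

theorem iff {P Q : (ℕ → M.Carrier) → Prop} (hP : Delta0 P) (hQ : Delta0 Q) :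
    Delta0 fun v => P v ↔ Q v :=
  congr (.and (.imp hP hQ) (.imp hQ hP)) fun v => by tauto

theorem const (p : Prop) : Delta0 fun _ : ℕ → M.Carrier => p := by
  have h : Delta0 fun v : ℕ → M.Carrier => v 0 = v 0 := .eq (.var 0) (.var 0)
  by_cases hp : p
  · exact congr h fun v => by simp [hp]
  · exact congr (.not h) fun v => by simp [hp]

/-- Every bounded quantifier formula defines a `Delta0` relation. -/
theorem of_realize {W : ℕ → Set M.Carrier} (hW : ∀ i, W i ∈ M.sets) (θ : BddFormula) :
    Delta0 fun v => M.Realize W v θ := by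
  have ev : ∀ t : NumTerm, IsTerm fun v : ℕ → M.Carrier => M.eval v t := by
    intro t
    induction t with
    | var i => exact .var i
    | zero => exact .const 0
    | one => exact .const 1
    | add _ _ h₁ h₂ => exact .add h₁ h₂
    | mul _ _ h₁ h₂ => exact .mul h₁ h₂
  induction θ with
  | eq s t => exact .eq (ev s) (ev t)
  | lt s t => exact .lt (ev s) (ev t)
  | mem t X => exact .mem (hW X) (ev t)
  | not _ h => exact .not h
  | and _ _ h₁ h₂ => exact .and h₁ h₂
  | ball t _ h => exact .ball_push (ev t) h

theorem subst₁ {R : M.Carrier → Prop} (h : Delta0 fun v => R (v 0))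
    {s : (ℕ → M.Carrier) → M.Carrier} (hs : IsTerm s) : Delta0 fun v => R (s v) :=
  h.subst (t := fun _ => s) fun _ => hs

theorem subst₂ {R : M.Carrier → M.Carrier → Prop} (h : Delta0 fun v => R (v 0) (v 1))
    {s t : (ℕ → M.Carrier) → M.Carrier} (hs : IsTerm s) (ht : IsTerm t) :
    Delta0 fun v => R (s v) (t v) :=
  h.subst (t := fun i => if i = 0 then s else t) fun i => by
    split_ifs <;> assumption

theorem subst₃ {R : M.Carrier → M.Carrier → M.Carrier → Prop}
    (h : Delta0 fun v => R (v 0) (v 1) (v 2))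
    {s t r : (ℕ → M.Carrier) → M.Carrier} (hs : IsTerm s) (ht : IsTerm t) (hr : IsTerm r) :
    Delta0 fun v => R (s v) (t v) (r v) :=
  h.subst (t := fun i => if i = 0 then s else if i = 1 then t else r) fun i => by
    split_ifs <;> assumption

theorem subst₄ {R : M.Carrier → M.Carrier → M.Carrier → M.Carrier → Prop}
    (h : Delta0 fun v => R (v 0) (v 1) (v 2) (v 3))
    {s t r q : (ℕ → M.Carrier) → M.Carrier} (hs : IsTerm s) (ht : IsTerm t) (hr : IsTerm r)
    (hq : IsTerm q) : Delta0 fun v => R (s v) (t v) (r v) (q v) :=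
  h.subst (t := fun i => if i = 0 then s else if i = 1 then t else if i = 2 then r else q)
    fun i => by split_ifs <;> assumption

/-- A formula for a `Delta0` relation in which the first `k` variables are those of the context
and the others are parameters. -/
theorem exists_formula_append {P : (ℕ → M.Carrier) → Prop} (h : Delta0 P) (k : ℕ)
    (hP : ∀ v w : ℕ → M.Carrier, (∀ i < k, v i = w i) → P v → P w) :
    ∃ (θ : BddFormula) (W : ℕ → Set M.Carrier) (σ : ℕ → M.Carrier), (∀ i, W i ∈ M.sets) ∧
      ∀ v : ℕ → M.Carrier, (∀ i, v (k + i) = σ i) → (P v ↔ M.Realize W v θ) := by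
  obtain ⟨θ, W, ρ, hW, h⟩ := h.exists_formula
  refine ⟨θ.rename id fun i => (ρ i).elim (fun j => if j < k then j else k + i) fun _ => k + i,
    W, fun i => (ρ i).elim (fun _ => 0) id, hW, fun v hv => ?_⟩
  -- `P` ignores the variables from `k` on, so slots reading them can be turned into parameters with
  -- the default value 0.
  have hP' : P v ↔ P fun i => if i < k then v i else 0 :=
    ⟨hP _ _ fun i hi => by simp [hi], hP _ _ fun i hi => by simp [hi]⟩
  rw [hP', h, realize_rename, Function.comp_id]
  suffices H : look ρ (fun i => if i < k then v i else 0) = v ∘ fun i =>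
      (ρ i).elim (fun j => if j < k then j else k + i) fun _ => k + i by rw [H]
  funext i
  rcases hi : ρ i with j | c
  · by_cases hj : j < k
    · simp [look, hi, hj]
    · simp [look, hi, hj, hv]
  · simp [look, hi, hv]

theorem isSigma1 {Q : M.Carrier → M.Carrier → Prop} (h : Delta0 fun v => Q (v 0) (v 1)) :
    M.IsSigma1 fun n => ∃ x, Q x n := by
  obtain ⟨θ, W, σ, hW, h⟩ := h.exists_formula_append 2 fun v w hvw hv => by
    rwa [← hvw 0 (by simp), ← hvw 1 (by simp)]
  refine ⟨θ, W, σ, hW, fun n => exists_congr fun x => ?_⟩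
  rw [← h (push x (push n σ)) fun i => by rw [Nat.add_comm]; rfl]; rfl

theorem isPi1 {Q : M.Carrier → M.Carrier → Prop} (h : Delta0 fun v => Q (v 0) (v 1)) :
    M.IsPi1 fun n => ∀ x, Q x n := by
  obtain ⟨θ, W, σ, hW, h⟩ := h.exists_formula_append 2 fun v w hvw hv => by
    rwa [← hvw 0 (by simp), ← hvw 1 (by simp)]
  refine ⟨θ, W, σ, hW, fun n => forall_congr' fun x => ?_⟩
  rw [← h (push x (push n σ)) fun i => by rw [Nat.add_comm]; rfl]; rfl

theorem isSigma2 {Q : M.Carrier → M.Carrier → M.Carrier → Prop}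
    (h : Delta0 fun v => Q (v 0) (v 1) (v 2)) : M.IsSigma2 fun n => ∃ x, ∀ y, Q y x n := by
  obtain ⟨θ, W, σ, hW, h⟩ := h.exists_formula_append 3 fun v w hvw hv => by
    rwa [← hvw 0 (by simp), ← hvw 1 (by simp), ← hvw 2 (by simp)]
  refine ⟨θ, W, σ, hW, fun n => exists_congr fun x => forall_congr' fun y => ?_⟩
  rw [← h (push y (push x (push n σ))) fun i => by rw [Nat.add_comm]; rfl]; rfl

end Delta0

theorem IsSigma2.exists_delta0 {P : M.Carrier → Prop} (h : M.IsSigma2 P) :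
    ∃ Q : M.Carrier → M.Carrier → M.Carrier → Prop,
      (Delta0 fun v => Q (v 0) (v 1) (v 2)) ∧ ∀ n, P n ↔ ∃ x, ∀ y, Q n x y := by
  obtain ⟨θ, W, σ, hW, h⟩ := h
  refine ⟨fun n x y => M.Realize W (push y (push x (push n σ))) θ, ?_, h⟩
  refine (Delta0.of_realize hW θ).subst
    (t := fun i v => push (v 2) (push (v 1) (push (v 0) σ)) i) fun i => ?_
  match i with
  | 0 => exact .var 2
  | 1 => exact .var 1
  | 2 => exact .var 0
  | i + 3 => exact .const (σ i)

/-! ## Blocks of vertices, and facts on graphs in any structure -/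

/-- The `i`-th element of the block of vertices attached to `(m, x)`. -/
def block (m x i : M.Carrier) : M.Carrier := pair (pair m x) i + pair (pair m x) i

theorem IsTerm.block {r s t : (ℕ → M.Carrier) → M.Carrier} (hr : IsTerm r) (hs : IsTerm s)
    (ht : IsTerm t) : IsTerm fun v => Structure2.block (r v) (s v) (t v) :=
  .add (.pair (.pair hr hs) ht) (.pair (.pair hr hs) ht)

theorem Graph.E_comm (G : M.Graph) {x y : M.Carrier} : pair x y ∈ G.E ↔ pair y x ∈ G.E :=
  ⟨G.symm x y, G.symm y x⟩

theorem Graph.IsRandom.not_extensionFails {G : M.Graph} (hG : G.IsRandom) (n : M.Carrier) :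
    ¬ G.ExtensionFails n := by
  rintro ⟨A, B, ⟨hA, hB, hAV, hBV, hAB, a, b, ha, hb, -⟩, h⟩
  exact h (hG A hA B hB ha.1 hb.1 hAV hBV hAB)

/-! ## Arithmetic in a model of `RCA₀` -/

variable [hM : Fact M.ModelsRCA0]

theorem delta0_induction {P : M.Carrier → Prop} (hP : Delta0 fun v => P (v 0)) (h0 : P 0)
    (h1 : ∀ n, P n → P (n + 1)) (n : M.Carrier) : P n := by
  -- A dummy quantifier puts the bounded formula in Σ⁰₁ form.
  have h : M.IsSigma1 fun n => ∃ _ : M.Carrier, P n :=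
    Delta0.isSigma1 (Q := fun _ n => P n) (hP.rename fun i => i + 1)
  simp only [exists_const_iff, show Nonempty M.Carrier from ⟨0⟩, true_and] at h
  exact hM.out.sigma1_induction P h h0 h1 n

theorem sigma1_induction {Q : M.Carrier → M.Carrier → Prop} (hQ : Delta0 fun v => Q (v 0) (v 1))
    (h0 : ∃ x, Q x 0) (h1 : ∀ n, (∃ x, Q x n) → ∃ x, Q x (n + 1)) (n : M.Carrier) :
    ∃ x, Q x n :=
  hM.out.sigma1_induction _ hQ.isSigma1 h0 h1 n

namespace Arith

variable (a b c : M.Carrier)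

theorem add_zero : a + 0 = a := hM.out.add_zero a

theorem add_succ : a + (b + 1) = a + b + 1 := hM.out.add_add_one a b

theorem zero_add : 0 + a = a := by
  refine delta0_induction (P := fun a => 0 + a = a) ?_ (add_zero 0) (fun n ih => ?_) a
  · exact .eq (.add (.const 0) (.var 0)) (.var 0)
  · rw [add_succ, ih]

theorem succ_add : a + 1 + b = a + b + 1 := by
  refine delta0_induction (P := fun b => a + 1 + b = a + b + 1) ?_ ?_ (fun n ih => ?_) b
  · exact .eq (.add (.const _) (.var 0)) (.add (.add (.const _) (.var 0)) (.const _))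
  · rw [add_zero, add_zero]
  · rw [add_succ, ih, add_succ]

theorem add_comm : a + b = b + a := by
  refine delta0_induction (P := fun b => a + b = b + a) ?_ ?_ (fun n ih => ?_) b
  · exact .eq (.add (.const _) (.var 0)) (.add (.var 0) (.const _))
  · rw [add_zero, zero_add]
  · rw [add_succ, ih, succ_add]

theorem add_assoc : a + b + c = a + (b + c) := by
  refine delta0_induction (P := fun c => a + b + c = a + (b + c)) ?_ ?_ (fun n ih => ?_) c
  · exact .eq (.add (.const _) (.var 0)) (.add (.const _) (.add (.const _) (.var 0)))
  · rw [add_zero, add_zero]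
  · rw [add_succ, ih, add_succ, add_succ]

theorem mul_zero : a * 0 = 0 := hM.out.mul_zero a

theorem mul_succ : a * (b + 1) = a * b + a := hM.out.mul_add_one a b

theorem zero_mul : 0 * a = 0 := by
  refine delta0_induction (P := fun a => 0 * a = 0) ?_ (mul_zero 0) (fun n ih => ?_) a
  · exact .eq (.mul (.const 0) (.var 0)) (.const 0)
  · rw [mul_succ, ih, add_zero]

theorem succ_mul : (a + 1) * b = a * b + b := by
  refine delta0_induction (P := fun b => (a + 1) * b = a * b + b) ?_ ?_ (fun n ih => ?_) b
  · exact .eq (.mul (.const _) (.var 0)) (.add (.mul (.const _) (.var 0)) (.var 0))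
  · rw [mul_zero, mul_zero, add_zero]
  · rw [mul_succ, ih, mul_succ, add_succ (a * n + n), add_assoc (a * n) n a, add_comm n a,
      ← add_assoc, add_succ]

theorem mul_comm : a * b = b * a := by
  refine delta0_induction (P := fun b => a * b = b * a) ?_ ?_ (fun n ih => ?_) b
  · exact .eq (.mul (.const _) (.var 0)) (.mul (.var 0) (.const _))
  · rw [mul_zero, zero_mul]
  · rw [mul_succ, ih, succ_mul]

theorem mul_add : a * (b + c) = a * b + a * c := by
  refine delta0_induction (P := fun c => a * (b + c) = a * b + a * c) ?_ ?_ (fun n ih => ?_) c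
  · exact .eq (.mul (.const _) (.add (.const _) (.var 0)))
      (.add (.const _) (.mul (.const _) (.var 0)))
  · rw [mul_zero, add_zero, add_zero]
  · rw [add_succ, mul_succ, ih, mul_succ, add_assoc]

theorem mul_assoc : a * b * c = a * (b * c) := by
  refine delta0_induction (P := fun c => a * b * c = a * (b * c)) ?_ ?_ (fun n ih => ?_) c
  · exact .eq (.mul (.const _) (.var 0)) (.mul (.const _) (.mul (.const _) (.var 0)))
  · rw [mul_zero, mul_zero, mul_zero]
  · rw [mul_succ, ih, mul_succ, mul_add]

theorem one_mul : 1 * a = a := by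
  rw [← zero_add (1 : M.Carrier), succ_mul, zero_mul, zero_add]

variable {a b c}

theorem lt_succ_iff : a < b + 1 ↔ a < b ∨ a = b := hM.out.lt_add_one_iff a b

theorem zero_lt_or_eq : 0 < a ∨ 0 = a := by
  refine delta0_induction (P := fun a => 0 < a ∨ 0 = a) ?_ (Or.inr rfl) (fun n ih => ?_) a
  · exact .or (.lt (.const _) (.var 0)) (.eq (.const _) (.var 0))
  · exact Or.inl (lt_succ_iff.2 ih)

theorem lt_trans (h : a < b) : b < c → a < c := by
  refine delta0_induction (P := fun c => b < c → a < c) ?_ ?_ (fun n ih => ?_) c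
  · exact .imp (.lt (.const _) (.var 0)) (.lt (.const _) (.var 0))
  · exact fun h => (hM.out.not_lt_zero _ h).elim
  · rw [lt_succ_iff, lt_succ_iff]
    rintro (h' | rfl)
    exacts [Or.inl (ih h'), Or.inl h]

theorem lt_irrefl : ¬ a < a := by
  refine delta0_induction (P := fun a => ¬ a < a) ?_ (hM.out.not_lt_zero 0) (fun n ih => ?_) a
  · exact .not (.lt (.var 0) (.var 0))
  · intro h
    have hn : n < n + 1 := lt_succ_iff.2 (Or.inr rfl)
    rcases lt_succ_iff.1 h with h' | h'
    · exact ih (lt_trans hn h')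
    · rw [h'] at hn; exact ih hn

theorem succ_le (h : a < b) : a + 1 < b ∨ a + 1 = b := by
  revert h
  refine delta0_induction (P := fun b => a < b → a + 1 < b ∨ a + 1 = b) ?_ ?_ (fun n ih => ?_) b
  · exact .imp (.lt (.const _) (.var 0)) (.or (.lt (.const _) (.var 0)) (.eq (.const _) (.var 0)))
  · exact fun h => (hM.out.not_lt_zero _ h).elim
  · intro h
    rcases lt_succ_iff.1 h with h' | rfl
    · exact Or.inl (lt_succ_iff.2 (ih h'))
    · exact Or.inr rfl

theorem lt_trichotomy : a < b ∨ a = b ∨ b < a := by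
  refine delta0_induction (P := fun b => a < b ∨ a = b ∨ b < a) ?_ ?_ (fun n ih => ?_) b
  · exact .or (.lt (.const _) (.var 0)) (.or (.eq (.const _) (.var 0)) (.lt (.var 0) (.const _)))
  · rcases zero_lt_or_eq (a := a) with h | h
    exacts [Or.inr (Or.inr h), Or.inr (Or.inl h.symm)]
  · rcases ih with h | rfl | h
    · exact Or.inl (lt_succ_iff.2 (Or.inl h))
    · exact Or.inl (lt_succ_iff.2 (Or.inr rfl))
    · rcases succ_le h with h | h
      exacts [Or.inr (Or.inr h), Or.inr (Or.inl h.symm)]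

theorem add_lt_add_right (h : a < b) (c : M.Carrier) : a + c < b + c := by
  refine delta0_induction (P := fun c => a + c < b + c) ?_ ?_ (fun n ih => ?_) c
  · exact .lt (.add (.const _) (.var 0)) (.add (.const _) (.var 0))
  · rwa [add_zero, add_zero]
  · rw [add_succ, add_succ, lt_succ_iff]
    rcases succ_le ih with h | h
    exacts [Or.inl h, Or.inr h]

/-- Σ⁰₁ induction on `b`: the difference starts at `c = 0` when `b` passes `a` and grows by one
afterwards. The guard `a < b` makes the earlier stages vacuous. -/
theorem exists_add_of_lt (h : a < b) : ∃ c, b = a + (c + 1) := by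
  have := sigma1_induction (Q := fun c b => a < b → b = a + (c + 1)) ?_ ?_ (fun n ih => ?_) b
  · obtain ⟨c, hc⟩ := this
    exact ⟨c, hc h⟩
  · exact .imp (.lt (.const _) (.var 1)) (.eq (.var 1) (.add (.const _) (.add (.var 0) (.const _))))
  · exact ⟨0, fun h => (hM.out.not_lt_zero _ h).elim⟩
  · obtain ⟨c, hc⟩ := ih
    rcases lt_trichotomy (a := a) (b := n) with h | h | h
    · exact ⟨c + 1, fun _ => by rw [add_succ, ← hc h]⟩
    · exact ⟨0, fun _ => by rw [zero_add, h]⟩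
    · refine ⟨0, fun h' => ?_⟩
      rcases lt_succ_iff.1 h' with h' | rfl
      exacts [(lt_irrefl (lt_trans h h')).elim, (lt_irrefl h).elim]

end Arith

/-! ### The ordered semiring of numbers -/

instance : CommSemiring M.Carrier where
  add_assoc := Arith.add_assoc
  zero_add := Arith.zero_add
  add_zero := Arith.add_zero
  add_comm := Arith.add_comm
  left_distrib := Arith.mul_add
  right_distrib a b c := by
    rw [Arith.mul_comm, Arith.mul_add, Arith.mul_comm c a, Arith.mul_comm c b]
  zero_mul := Arith.zero_mul
  mul_zero := Arith.mul_zero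
  mul_assoc := Arith.mul_assoc
  one_mul := Arith.one_mul
  mul_one a := by rw [Arith.mul_comm, Arith.one_mul]
  mul_comm := Arith.mul_comm
  nsmul := nsmulRec

noncomputable instance : LinearOrder M.Carrier where
  le a b := a < b ∨ a = b
  le_refl a := Or.inr rfl
  le_trans a b c := by
    rintro (h | rfl) (h' | rfl)
    exacts [Or.inl (Arith.lt_trans h h'), Or.inl h, Or.inl h', Or.inr rfl]
  lt_iff_le_not_ge a b := by
    constructor
    · refine fun h => ⟨Or.inl h, ?_⟩
      rintro (h' | rfl)
      exacts [Arith.lt_irrefl (Arith.lt_trans h h'), Arith.lt_irrefl h]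
    · rintro ⟨h | rfl, h'⟩
      exacts [h, (h' (Or.inr rfl)).elim]
  le_antisymm a b := by
    rintro (h | rfl) (h' | h')
    exacts [(Arith.lt_irrefl (Arith.lt_trans h h')).elim, h'.symm, rfl, rfl]
  le_total a b := by
    rcases Arith.lt_trichotomy (a := a) (b := b) with h | h | h
    exacts [Or.inl (Or.inl h), Or.inl (Or.inr h), Or.inr (Or.inl h)]
  toDecidableLE := Classical.decRel _

instance : CanonicallyOrderedAdd M.Carrier where
  exists_add_of_le := by
    rintro a b (h | rfl)
    · obtain ⟨c, hc⟩ := Arith.exists_add_of_lt h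
      exact ⟨_, hc⟩
    · exact ⟨0, (add_zero _).symm⟩
  le_add_self a b := by
    rcases Arith.zero_lt_or_eq (a := b) with h | rfl
    · left
      have := Arith.add_lt_add_right h a
      rwa [zero_add] at this
    · right; rw [zero_add]
  le_self_add a b := by
    rcases Arith.zero_lt_or_eq (a := b) with h | rfl
    · left
      have := Arith.add_lt_add_right h a
      rwa [zero_add, add_comm] at this
    · right; rw [add_zero]

theorem lt_add_one_iff' {a b : M.Carrier} : a < b + 1 ↔ a ≤ b := Arith.lt_succ_iff

theorem zero_le' (a : M.Carrier) : 0 ≤ a := Arith.zero_lt_or_eq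

instance : Nontrivial M.Carrier := ⟨0, 1, fun h => hM.out.add_one_ne_zero 0 (by rw [zero_add, h])⟩

instance : IsOrderedAddMonoid M.Carrier where
  add_le_add_left := by
    rintro a b (h | rfl) c
    exacts [(Arith.add_lt_add_right h c).le, le_rfl]

instance : IsOrderedCancelAddMonoid M.Carrier where
  le_of_add_le_add_left a b c h := by
    by_contra! h'
    have := Arith.add_lt_add_right h' a
    rw [add_comm b, add_comm c] at this
    exact absurd h this.not_ge

theorem exists_eq_add_one {a : M.Carrier} (h : 0 < a) : ∃ b, a = b + 1 := by
  obtain ⟨c, hc⟩ := Arith.exists_add_of_lt h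
  exact ⟨c, by rw [hc, zero_add]⟩

theorem mul_lt_mul_left' {a b c : M.Carrier} (hc : 0 < c) (h : a < b) : c * a < c * b := by
  obtain ⟨d, rfl⟩ := Arith.exists_add_of_lt h
  rw [mul_add, mul_add, mul_one, ← add_assoc]
  calc c * a ≤ c * a + c * d := le_self_add
    _ < _ := lt_add_of_pos_right _ hc

instance : IsStrictOrderedRing M.Carrier where
  zero_le_one := zero_le' 1
  mul_lt_mul_of_pos_left a ha b c h := mul_lt_mul_left' ha h
  mul_lt_mul_of_pos_right a ha b c h := by
    simpa only [mul_comm] using mul_lt_mul_left' ha h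

theorem add_one_le_iff' {a b : M.Carrier} : a + 1 ≤ b ↔ a < b := by
  rw [← lt_add_one_iff', add_lt_add_iff_right]

/-! ## Coding of finite sets -/

theorem le_mul_self' (a : M.Carrier) : a ≤ a * a := by
  rcases (zero_le' a).eq_or_lt with h | h
  · simp [← h]
  · have := mul_le_mul_right (add_one_le_iff'.2 h) a
    rwa [zero_add, mul_one] at this

theorem left_le_pair (i j : M.Carrier) : i ≤ pair i j := le_add_self

theorem right_le_pair (i j : M.Carrier) : j ≤ pair i j :=
  calc j ≤ i + j := le_add_self
    _ ≤ (i + j) * (i + j) := le_mul_self' _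
    _ ≤ pair i j := le_self_add

theorem pair_mono {i i' j j' : M.Carrier} (hi : i ≤ i') (hj : j ≤ j') :
    pair i j ≤ pair i' j' := by
  unfold pair; gcongr

/-- The code lies between the squares of `i + j` and `i + j + 1`, so it determines the sum;
cancelling the square leaves `i`. -/
theorem pair_inj {i i' j j' : M.Carrier} : pair i j = pair i' j' ↔ i = i' ∧ j = j' := by
  refine ⟨fun h => ?_, fun ⟨h₁, h₂⟩ => by rw [h₁, h₂]⟩
  have key : ∀ i j i' j' : M.Carrier, i + j < i' + j' → pair i j < pair i' j' := by
    intro i j i' j' h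
    have h₁ : (i + j + 1) * (i + j + 1) ≤ (i' + j') * (i' + j') :=
      mul_le_mul' (add_one_le_iff'.2 h) (add_one_le_iff'.2 h)
    have h₂ : pair i j < (i + j + 1) * (i + j + 1) := by
      have : (i + j + 1) * (i + j + 1) = pair i j + (i + 2 * j + 1) := by unfold pair; ring
      rw [this]
      exact lt_add_of_pos_right _ (lt_of_lt_of_le zero_lt_one le_add_self)
    exact h₂.trans_le (h₁.trans le_self_add)
  have hs : i + j = i' + j' := by
    rcases lt_trichotomy (i + j) (i' + j') with h' | h' | h'
    · exact absurd h (key _ _ _ _ h').ne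
    · exact h'
    · exact absurd h (key _ _ _ _ h').ne'
  have hi : i = i' := by
    unfold pair at h
    rw [hs] at h
    exact add_left_cancel h
  subst hi
  exact ⟨rfl, add_left_cancel hs⟩

namespace Delta0

theorem le {s t : (ℕ → M.Carrier) → M.Carrier} (hs : IsTerm s) (ht : IsTerm t) :
    Delta0 fun v => s v ≤ t v :=
  .or (.lt hs ht) (.eq hs ht)

theorem ball_le {t : (ℕ → M.Carrier) → M.Carrier} {P : M.Carrier → (ℕ → M.Carrier) → Prop}
    (ht : IsTerm t) (hP : Delta0 fun w => P (w 0) fun i => w (i + 1)) :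
    Delta0 fun v => ∀ a, a ≤ t v → P a v :=
  congr (ball (.add ht (.const 1)) hP) fun v => by simp only [lt_add_one_iff']

theorem bex_le {t : (ℕ → M.Carrier) → M.Carrier} {P : M.Carrier → (ℕ → M.Carrier) → Prop}
    (ht : IsTerm t) (hP : Delta0 fun w => P (w 0) fun i => w (i + 1)) :
    Delta0 fun v => ∃ a, a ≤ t v ∧ P a v :=
  congr (bex (.add ht (.const 1)) hP) fun v => by simp only [lt_add_one_iff']

end Delta0

/-! ### Comprehension, least numbers, collection and Π⁰₁ induction -/

theorem setOf_mem_sets {P : M.Carrier → Prop} (hP : Delta0 fun v => P (v 0)) :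
    {n | P n} ∈ M.sets := by
  have h₁ : M.IsSigma1 fun n => ∃ _ : M.Carrier, P n :=
    Delta0.isSigma1 (Q := fun _ n => P n) (hP.rename fun i => i + 1)
  have h₂ : M.IsPi1 fun n => ∀ _ : M.Carrier, P n :=
    Delta0.isPi1 (Q := fun _ n => P n) (hP.rename fun i => i + 1)
  simp only [exists_const_iff, show Nonempty M.Carrier from ⟨0⟩, true_and] at h₁
  simp only [forall_const] at h₂
  exact hM.out.delta1_comprehension P h₁ h₂

theorem setOf_exists_mem_sets {Q Q' : M.Carrier → M.Carrier → Prop}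
    (hQ : Delta0 fun v => Q (v 0) (v 1)) (hQ' : Delta0 fun v => Q' (v 0) (v 1))
    (h : ∀ n, (∃ x, Q x n) ↔ ∀ x, Q' x n) : {n | ∃ x, Q x n} ∈ M.sets := by
  refine hM.out.delta1_comprehension _ hQ.isSigma1 ?_
  simp only [h]
  exact hQ'.isPi1

theorem delta0_least {P : M.Carrier → Prop} (hP : Delta0 fun v => P (v 0)) {n : M.Carrier}
    (hn : P n) : ∃ n, P n ∧ ∀ m, m < n → ¬ P m := by
  by_contra! h
  have key : ∀ n, ∀ m, m < n → ¬ P m := by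
    refine delta0_induction (.ball (.var 0) (.not (hP.subst₁ (.var 0)))) ?_ fun n ih m hm h' => ?_
    · exact fun m hm => (not_lt_zero hm).elim
    · rcases (lt_add_one_iff'.1 hm).eq_or_lt with rfl | hm
      · obtain ⟨k, hk, hk'⟩ := h m h'
        exact ih k hk hk'
      · exact ih m hm h'
  exact key (n + 1) n (lt_add_one_iff'.2 le_rfl) hn

/-- Having a common bound `z` for the witnesses of all `a < n` is Σ⁰₁ in `n`, so the bound can be
enlarged one argument at a time. -/
theorem collection {Q : M.Carrier → M.Carrier → Prop} (hQ : Delta0 fun v => Q (v 0) (v 1))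
    (k : M.Carrier) (h : ∀ a, a < k → ∃ x, Q a x) :
    ∃ z, ∀ a, a < k → ∃ x, x < z ∧ Q a x := by
  have key := sigma1_induction
    (Q := fun z n => ∀ a, a < n → a < k → ∃ x, x < z ∧ Q a x) ?_ ?_ ?_ k
  · obtain ⟨z, hz⟩ := key
    exact ⟨z, fun a ha => hz a ha ha⟩
  · exact .ball (.var 1) (.imp (.lt (.var 0) (.const _))
      (.bex (.var 1) (hQ.subst₂ (.var 1) (.var 0))))
  · exact ⟨0, fun a ha => (not_lt_zero ha).elim⟩
  · rintro n ⟨z, hz⟩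
    by_cases hn : n < k
    · obtain ⟨x, hx⟩ := h n hn
      refine ⟨z + x + 1, fun a ha hak => ?_⟩
      rcases (lt_add_one_iff'.1 ha).eq_or_lt with rfl | ha
      · exact ⟨x, lt_add_one_iff'.2 le_add_self, hx⟩
      · obtain ⟨y, hy, hy'⟩ := hz a ha hak
        exact ⟨y, lt_add_one_iff'.2 (hy.le.trans le_self_add), hy'⟩
    · refine ⟨z, fun a ha hak => ?_⟩
      rcases (lt_add_one_iff'.1 ha).eq_or_lt with rfl | ha
      exacts [(hn hak).elim, hz a ha hak]

/-- Σ⁰₁ induction run downwards: a failure at `n` moves to a failure at `n - k` for each `k`, and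
finally to 0. -/
theorem pi1_induction {Q : M.Carrier → M.Carrier → Prop} (hQ : Delta0 fun v => Q (v 0) (v 1))
    (h0 : ∀ x, Q x 0) (h1 : ∀ n, (∀ x, Q x n) → ∀ x, Q x (n + 1)) (n : M.Carrier) :
    ∀ x, Q x n := by
  by_contra! hn
  obtain ⟨x₀, hx₀⟩ := hn
  -- The disjunct `n < k` absorbs the steps below 0, and `z` bounds the counterexample `x` at `j = n
  -- - k`.
  have key := sigma1_induction
    (Q := fun z k => n < k ∨ ∃ x, x ≤ z ∧ ∃ j, j ≤ n ∧ j + k = n ∧ ¬ Q x j) ?_ ?_ ?_ n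
  · obtain ⟨z, h | ⟨x, -, j, -, hj, hx⟩⟩ := key
    · exact lt_irrefl _ h
    · rw [add_eq_right.1 hj] at hx
      exact hx (h0 x)
  · refine .or (.lt (.const _) (.var 1)) (.bex_le (.var 0) (.bex_le (.const _) (.and ?_ ?_)))
    · exact .eq (.add (.var 0) (.var 3)) (.const _)
    · exact .not (hQ.subst₂ (.var 1) (.var 0))
  · exact ⟨x₀, Or.inr ⟨x₀, le_rfl, n, le_rfl, add_zero n, hx₀⟩⟩
  · rintro k ⟨z, h | ⟨x, -, j, hjn, hj, hx⟩⟩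
    · exact ⟨0, Or.inl (h.trans (lt_add_one_iff'.2 le_rfl))⟩
    · rcases (zero_le' j).eq_or_lt with rfl | hj0
      · exact ⟨0, Or.inl (by rw [← hj, zero_add]; exact lt_add_one_iff'.2 le_rfl)⟩
      · obtain ⟨i, rfl⟩ := exists_eq_add_one hj0
        have : ¬ ∀ x, Q x i := fun h => hx (h1 i h x)
        push Not at this
        obtain ⟨y, hy⟩ := this
        exact ⟨y, Or.inr ⟨y, le_rfl, i, le_self_add.trans hjn, by rw [← hj]; ring, hy⟩⟩

/-! ### Divisibility and codes of finite sets -/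

theorem dvd_of_dvd_add {p a b : M.Carrier} (h : p ∣ a + b) (ha : p ∣ a) : p ∣ b := by
  obtain ⟨c, hc⟩ := h
  obtain ⟨d, rfl⟩ := ha
  rcases le_total d c with h | h
  · obtain ⟨e, rfl⟩ := exists_add_of_le h
    rw [mul_add] at hc
    exact ⟨e, add_left_cancel hc⟩
  · have h' : p * c ≤ p * d := mul_le_mul_right h p
    rw [← hc] at h'
    have : b = 0 := by
      have := le_antisymm h' le_self_add
      exact add_eq_left.1 this
    rw [this]
    exact dvd_zero p

/-- Since `p` is 1 modulo `b`, it is coprime to `b`; explicitly, `s * (y * b) + y = y * p`. -/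
theorem dvd_of_dvd_mul_of_eq {p b y s : M.Carrier} (hp : p = 1 + s * b) (h : p ∣ y * b) :
    p ∣ y := by
  have : p ∣ s * (y * b) + y := ⟨y, by rw [hp]; ring⟩
  exact dvd_of_dvd_add this (h.mul_left s)

/-- The moduli of the code are pairwise coprime. -/
theorem dvd_of_dvd_mul_modulus {b k x j a : M.Carrier} (hb : ∀ i, i < k → i + 1 ∣ b)
    (hx : x < k) (hj : j < k) (hxj : x ≠ j) (h : 1 + (x + 1) * b ∣ a * (1 + (j + 1) * b)) :
    1 + (x + 1) * b ∣ a := by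
  -- The two moduli differ by `e * b`, where `e` is the distance of `x` and `j` and hence divides
  -- `b`. So the modulus divides `a * b * b`, and `b` can be cancelled twice.
  have key : ∃ e, e ∣ b ∧ 1 + (x + 1) * b ∣ a * e * b := by
    rcases lt_or_gt_of_ne hxj with hlt | hlt
    · obtain ⟨e, rfl⟩ := Arith.exists_add_of_lt hlt
      refine ⟨e + 1, hb e (lt_of_le_of_lt ?_ hj), ?_⟩
      · exact le_self_add.trans le_add_self
      · have h' : a * (1 + (x + (e + 1) + 1) * b) =
            a * (1 + (x + 1) * b) + a * (e + 1) * b := by ring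
        rw [h'] at h
        exact dvd_of_dvd_add h (dvd_mul_left _ _)
    · obtain ⟨e, rfl⟩ := Arith.exists_add_of_lt hlt
      refine ⟨e + 1, hb e (lt_of_le_of_lt ?_ hx), ?_⟩
      · exact le_self_add.trans le_add_self
      · refine dvd_of_dvd_add (a := a * (1 + (j + 1) * b)) ?_ h
        exact ⟨a, by ring⟩
  obtain ⟨e, ⟨c, hc⟩, he⟩ := key
  refine dvd_of_dvd_mul_of_eq rfl (dvd_of_dvd_mul_of_eq (s := x + 1) (b := b) rfl ?_)
  have : a * b * b = c * (a * e * b) := by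
    nth_rewrite 1 [hc]; ring
  rw [this]
  exact he.mul_left c

theorem dvd_iff_bounded {p a : M.Carrier} (hp : 0 < p) : p ∣ a ↔ ∃ q, q ≤ a ∧ p * q = a := by
  constructor
  · rintro ⟨q, rfl⟩
    refine ⟨q, ?_, rfl⟩
    have := mul_le_mul_left (add_one_le_iff'.2 hp) q
    rwa [zero_add, one_mul] at this
  · rintro ⟨q, -, rfl⟩
    exact ⟨q, rfl⟩

/-- `u` belongs to the finite set with the code `w`. -/
def MemCode (u w : M.Carrier) : Prop :=
  ∃ a, a ≤ w ∧ ∃ b, b ≤ w ∧ ∃ k, k ≤ w ∧ w = pair (pair a b) k ∧ u < k ∧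
    ∃ q, q ≤ a ∧ (1 + (u + 1) * b) * q = a

theorem memCode_pair {u a b k : M.Carrier} :
    MemCode u (pair (pair a b) k) ↔ u < k ∧ 1 + (u + 1) * b ∣ a := by
  have hp : ∀ b, 0 < 1 + (u + 1) * b := fun b => lt_of_lt_of_le zero_lt_one le_self_add
  constructor
  · rintro ⟨a', -, b', -, k', -, h, hu, h'⟩
    rw [pair_inj, pair_inj] at h
    obtain ⟨⟨rfl, rfl⟩, rfl⟩ := h
    exact ⟨hu, (dvd_iff_bounded (hp _)).2 h'⟩
  · rintro ⟨hu, h⟩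
    exact ⟨a, (left_le_pair a b).trans (left_le_pair _ _), b,
      (right_le_pair a b).trans (left_le_pair _ _), k, right_le_pair _ _, rfl, hu,
      (dvd_iff_bounded (hp _)).1 h⟩

theorem MemCode.lt {u w : M.Carrier} (h : MemCode u w) : u < w := by
  obtain ⟨a, -, b, -, k, hk, -, hu, -⟩ := h
  exact hu.trans_le hk

theorem Delta0.memCode {s t : (ℕ → M.Carrier) → M.Carrier} (hs : IsTerm s) (ht : IsTerm t) :
    Delta0 fun v => MemCode (s v) (t v) := by
  refine Delta0.subst₂ ?_ hs ht
  unfold MemCode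
  repeat' first
    | exact .var _ | exact .const _ | refine .add ?_ ?_ | refine .mul ?_ ?_
    | refine .pair ?_ ?_ | refine .eq ?_ ?_ | refine .lt ?_ ?_ | refine .le ?_ ?_ | refine .not ?_
    | refine .and ?_ ?_ | refine .bex_le ?_ ?_

/-- A substitute for the factorial, built by Σ⁰₁ induction with bounded quotients. -/
theorem exists_common_multiple (k K : M.Carrier) : ∃ b, K < b ∧ ∀ i, i < k → i + 1 ∣ b := by
  have key := sigma1_induction
    (Q := fun b k => K < b ∧ ∀ i, i < k → ∃ q, q ≤ b ∧ (i + 1) * q = b) ?_ ?_ ?_ k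
  · obtain ⟨b, hb, hb'⟩ := key
    exact ⟨b, hb, fun i hi =>
      (dvd_iff_bounded (lt_add_one_iff'.2 (zero_le' i))).2 (hb' i hi)⟩
  · repeat' first
      | exact .var _ | exact .const _ | refine .add ?_ ?_ | refine .mul ?_ ?_
      | refine .eq ?_ ?_ | refine .lt ?_ ?_
      | refine .and ?_ ?_ | refine .bex_le ?_ ?_ | refine .ball ?_ ?_
  · exact ⟨K + 1, lt_add_one_iff'.2 le_rfl, fun i hi => (not_lt_zero hi).elim⟩
  · rintro n ⟨b, hb, hb'⟩
    have hbb : b ≤ b * (n + 1) := by rw [mul_add, mul_one]; exact le_add_self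
    refine ⟨b * (n + 1), hb.trans_le hbb, fun i hi => ?_⟩
    rcases (lt_add_one_iff'.1 hi).eq_or_lt with rfl | hi
    · exact ⟨b, hbb, mul_comm _ _⟩
    · obtain ⟨q, hq, hq'⟩ := hb' i hi
      exact ⟨q * (n + 1), mul_le_mul_left hq _, by rw [← hq']; ring⟩

/-- Every bounded part of a `Delta0` set has arbitrarily large codes. -/
theorem exists_code {P : M.Carrier → Prop} (hP : Delta0 fun v => P (v 0)) (k K : M.Carrier) :
    ∃ w, K ≤ w ∧ ∀ u, MemCode u w ↔ u < k ∧ P u := by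
  -- `b > K` makes the final code at least `K`, and makes every modulus exceed 1.
  obtain ⟨b, hKb, hb⟩ := exists_common_multiple k K
  have hb0 : 0 < b := (zero_le' K).trans_lt hKb
  have hpos : ∀ x : M.Carrier, 0 < 1 + (x + 1) * b :=
    fun x => lt_of_lt_of_le zero_lt_one le_self_add
  -- The number `a` is the product of the moduli of those `x < j` that satisfy `P`, starting from
  -- the empty product 1.
  have key := sigma1_induction (Q := fun a j => j ≤ k →
    ∀ x, x < k → ((∃ q, q ≤ a ∧ (1 + (x + 1) * b) * q = a) ↔ x < j ∧ P x)) ?_ ?_ ?_ k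
  · obtain ⟨a, ha⟩ := key
    refine ⟨pair (pair a b) k, ?_, fun u => ?_⟩
    · exact hKb.le.trans ((right_le_pair a b).trans (left_le_pair _ _))
    · rw [memCode_pair]
      refine and_congr_right fun hu => ?_
      rw [dvd_iff_bounded (hpos u), ha le_rfl u hu, and_iff_right hu]
  · repeat' first
      | exact .var _ | exact .const _ | refine .add ?_ ?_ | refine .mul ?_ ?_
      | refine hP.subst₁ ?_ | refine .eq ?_ ?_ | refine .lt ?_ ?_ | refine .le ?_ ?_
      | refine .and ?_ ?_ | refine .bex_le ?_ ?_ | refine .ball ?_ ?_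
      | refine .iff ?_ ?_ | refine .imp ?_ ?_
  · refine ⟨1, fun _ x _ => ?_⟩
    rw [← dvd_iff_bounded (hpos x)]
    refine ⟨fun h => ?_, fun h => (not_lt_zero h.1).elim⟩
    obtain ⟨q, hq, hq'⟩ := (dvd_iff_bounded (hpos x)).1 h
    exfalso
    have h1 : 1 + (x + 1) * b ≤ 1 := by
      rcases (zero_le' q).eq_or_lt with rfl | hq0
      · simp at hq'
      · calc 1 + (x + 1) * b ≤ (1 + (x + 1) * b) * q :=
              le_mul_of_one_le_right (zero_le' _) (by simpa using add_one_le_iff'.2 hq0)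
          _ = 1 := hq'
    have h2 : 0 < (x + 1) * b := mul_pos (lt_add_one_iff'.2 (zero_le' x)) hb0
    exact absurd h1 (lt_add_of_pos_right 1 h2).not_ge
  · rintro j ⟨a, ha⟩
    by_cases hjk : j + 1 ≤ k
    swap
    · exact ⟨0, fun h => (hjk h).elim⟩
    have hjk' : j < k := add_one_le_iff'.1 hjk
    by_cases hPj : P j
    · refine ⟨a * (1 + (j + 1) * b), fun _ x hx => ?_⟩
      have hax := ha hjk'.le x hx
      rw [← dvd_iff_bounded (hpos x)] at hax ⊢
      by_cases hxj : x = j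
      · subst hxj
        simp [hPj]
      · constructor
        · intro h
          obtain ⟨h₁, h₂⟩ := hax.1 (dvd_of_dvd_mul_modulus hb hx hjk' hxj h)
          exact ⟨lt_add_one_iff'.2 h₁.le, h₂⟩
        · rintro ⟨h₁, h₂⟩
          exact (hax.2 ⟨lt_of_le_of_ne (lt_add_one_iff'.1 h₁) hxj, h₂⟩).mul_right _
    · refine ⟨a, fun _ x hx => ?_⟩
      rw [ha hjk'.le x hx]
      constructor
      · rintro ⟨h₁, h₂⟩
        exact ⟨lt_add_one_iff'.2 h₁.le, h₂⟩
      · rintro ⟨h₁, h₂⟩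
        refine ⟨lt_of_le_of_ne (lt_add_one_iff'.1 h₁) ?_, h₂⟩
        rintro rfl
        exact hPj h₂

/-- Every bounded part of a `Delta0` relation has a code. -/
theorem exists_rel_code {R : M.Carrier → M.Carrier → Prop} (hR : Delta0 fun v => R (v 0) (v 1))
    (m a : M.Carrier) :
    ∃ c, ∀ x y, MemCode (pair x y) c ↔ x < m ∧ y < a ∧ R x y := by
  have h : Delta0 fun v : ℕ → M.Carrier => ∃ x, x ≤ v 0 ∧ ∃ y, y ≤ v 0 ∧
      v 0 = pair x y ∧ x < m ∧ y < a ∧ R x y := by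
    repeat' first
      | exact .var _ | exact .const _ | refine .pair ?_ ?_ | refine hR.subst₂ ?_ ?_
      | refine .eq ?_ ?_ | refine .lt ?_ ?_ | refine .and ?_ ?_ | refine .bex_le ?_ ?_
  obtain ⟨c, -, hc⟩ := exists_code (P := fun e => ∃ x, x ≤ e ∧ ∃ y, y ≤ e ∧
    e = pair x y ∧ x < m ∧ y < a ∧ R x y) h (pair m a) 0
  refine ⟨c, fun x y => ?_⟩
  rw [hc]
  constructor
  · rintro ⟨-, x', -, y', -, he, h⟩
    obtain ⟨rfl, rfl⟩ := pair_inj.1 he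
    exact h
  · rintro ⟨h₁, h₂, h₃⟩
    refine ⟨?_, x, left_le_pair _ _, y, right_le_pair _ _, rfl, h₁, h₂, h₃⟩
    refine lt_of_le_of_ne (pair_mono h₁.le h₂.le) fun h => ?_
    exact h₁.ne (pair_inj.1 h).1

/-- The pigeonhole principle for coded relations. -/
theorem pigeonhole_code (a m c : M.Carrier)
    (htot : ∀ x, x < m → ∃ y, y < a ∧ MemCode (pair x y) c)
    (hinj : ∀ x, x < m → ∀ x', x' < m → ∀ y, y < a →
      MemCode (pair x y) c → MemCode (pair x' y) c → x = x') : m ≤ a := by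
  -- The step replaces the relation, so the hypothesis must cover all codes. A single unbounded `z`
  -- above `m` and `c` keeps it Π⁰₁.
  have key := pi1_induction (Q := fun z a => ∀ m, m ≤ z → ∀ c, c ≤ z →
    (∀ x, x < m → ∃ y, y < a ∧ MemCode (pair x y) c) →
    (∀ x, x < m → ∀ x', x' < m → ∀ y, y < a →
      MemCode (pair x y) c → MemCode (pair x' y) c → x = x') → m ≤ a) ?_ ?_ ?_ a (m + c)
  · exact key m le_self_add c le_add_self htot hinj
  · repeat' first
      | exact .var _ | exact .const _ | refine .pair ?_ ?_ | refine .memCode ?_ ?_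
      | refine .eq ?_ ?_ | refine .lt ?_ ?_ | refine .le ?_ ?_ | refine .and ?_ ?_
      | refine .bex ?_ ?_ | refine .ball ?_ ?_ | refine .ball_le ?_ ?_ | refine .imp ?_ ?_
  · intro z m _ c _ htot _
    by_contra hm
    obtain ⟨y, hy, -⟩ := htot 0 (not_le.1 hm)
    exact not_lt_zero hy
  · intro a ih z m _ c _ htot hinj
    rcases (zero_le' m).eq_or_lt with rfl | hm
    · exact zero_le' _
    obtain ⟨m, rfl⟩ := exists_eq_add_one hm
    rw [add_le_add_iff_right]
    have hlt : ∀ {x y : M.Carrier}, x < y → x < y + 1 := fun h => lt_add_one_iff'.2 h.le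
    have hmm : m < m + 1 := lt_add_one_iff'.2 le_rfl
    obtain ⟨y₀, hy₀, hmy₀⟩ := htot m hmm
    -- Drop the argument `m` and redirect to its freed value `y₀` whatever was sent to `a`.
    have hR : Delta0 fun v : ℕ → M.Carrier =>
        MemCode (pair (v 0) (v 1)) c ∨ v 1 = y₀ ∧ MemCode (pair (v 0) a) c := by
      repeat' first
        | exact .var _ | exact .const _ | refine .pair ?_ ?_ | refine .memCode ?_ ?_
        | refine .eq ?_ ?_ | refine .and ?_ ?_ | refine .or ?_ ?_
    obtain ⟨c', hc'⟩ := exists_rel_code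
      (R := fun x y => MemCode (pair x y) c ∨ y = y₀ ∧ MemCode (pair x a) c) hR m a
    have hne : ∀ x, x < m → ∀ y, y < a + 1 → MemCode (pair x y) c → y ≠ y₀ := by
      rintro x hx y hy h rfl
      exact hx.ne (hinj x (hlt hx) m hmm y hy h hmy₀)
    have ha : a < a + 1 := lt_add_one_iff'.2 le_rfl
    refine ih (m + c') m le_self_add c' le_add_self (fun x hx => ?_) fun x hx x' hx' y hy h h' => ?_
    · obtain ⟨y, hy, hxy⟩ := htot x (hlt hx)
      rcases (lt_add_one_iff'.1 hy).eq_or_lt with rfl | hy'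
      · have hy₀' : y₀ < y :=
          lt_of_le_of_ne (lt_add_one_iff'.1 hy₀) (hne x hx y hy hxy).symm
        exact ⟨y₀, hy₀', (hc' _ _).2 ⟨hx, hy₀', Or.inr ⟨rfl, hxy⟩⟩⟩
      · exact ⟨y, hy', (hc' _ _).2 ⟨hx, hy', Or.inl hxy⟩⟩
    · obtain ⟨-, -, h⟩ := (hc' _ _).1 h
      obtain ⟨-, -, h'⟩ := (hc' _ _).1 h'
      rcases h with h | ⟨rfl, h⟩ <;> rcases h' with h' | ⟨h'', h'⟩
      · exact hinj x (hlt hx) x' (hlt hx') y (hlt hy) h h'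
      · exact (hne x hx y (hlt hy) h h'').elim
      · exact (hne x' hx' y (hlt hy) h' rfl).elim
      · exact hinj x (hlt hx) x' (hlt hx') a ha h h'

/-- The pigeonhole principle for `Delta0` relations. -/
theorem pigeonhole {R : M.Carrier → M.Carrier → Prop} (hR : Delta0 fun v => R (v 0) (v 1))
    {a m : M.Carrier} (htot : ∀ x, x < m → ∃ y, y < a ∧ R x y)
    (hinj : ∀ x, x < m → ∀ x', x' < m → ∀ y, y < a → R x y → R x' y → x = x') : m ≤ a := by
  obtain ⟨c, hc⟩ := exists_rel_code hR m a
  refine pigeonhole_code a m c (fun x hx => ?_) fun x hx x' hx' y hy h h' => ?_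
  · obtain ⟨y, hy, h⟩ := htot x hx
    exact ⟨y, hy, (hc _ _).2 ⟨hx, hy, h⟩⟩
  · exact hinj x hx x' hx' y hy ((hc _ _).1 h).2.2 ((hc _ _).1 h').2.2

/-! ## The graph of a `Σ⁰₂` formula -/

theorem lt_double_succ (a : M.Carrier) : a < a + a + 1 :=
  lt_add_one_iff'.2 le_self_add

theorem double_ne_double_succ (a w : M.Carrier) : a + a ≠ w + w + 1 := by
  have h01 : (0 : M.Carrier) < 1 := zero_lt_one
  rcases le_or_gt a w with h | h
  · grind
  · have := add_one_le_iff'.2 h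
    grind

theorem double_succ_inj {w w' : M.Carrier} (h : w + w + 1 = w' + w' + 1) : w = w' := by
  rcases lt_trichotomy w w' with h' | h' | h'
  all_goals grind

theorem pair_le_block (m x i : M.Carrier) : pair m x ≤ block m x i :=
  (left_le_pair _ i).trans le_self_add

theorem block_inj {m x i i' : M.Carrier} (h : block m x i = block m x i') : i = i' := by
  refine (pair_inj.1 (double_succ_inj (w := pair (pair m x) i) (w' := pair (pair m x) i') ?_)).2
  exact congrArg (· + 1) h

/-- Every block contained in the set coded by `w` has a counterexample to `Q` below `z`. -/
def Allowed (Q : M.Carrier → M.Carrier → M.Carrier → Prop) (w z : M.Carrier) : Prop :=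
  ∀ m, m ≤ z → ∀ x, x ≤ z → (∀ i, i < m + 1 → MemCode (block m x i) w) → ∃ y, y < z ∧ ¬ Q m x y

/-- The vertex `u` is joined to the larger vertex `z`. -/
def LowAdj (Q : M.Carrier → M.Carrier → M.Carrier → Prop) (u z : M.Carrier) : Prop :=
  u < z ∧ ∃ w, w ≤ z ∧ z = w + w + 1 ∧ MemCode u w ∧ Allowed Q w z

theorem Delta0.lowAdj {Q : M.Carrier → M.Carrier → M.Carrier → Prop}
    (hQ : Delta0 fun v => Q (v 0) (v 1) (v 2)) {s t : (ℕ → M.Carrier) → M.Carrier}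
    (hs : IsTerm s) (ht : IsTerm t) : Delta0 fun v => LowAdj Q (s v) (t v) := by
  refine Delta0.subst₂ ?_ hs ht
  unfold LowAdj Allowed
  repeat' first
    | exact .var _ | exact .const _ | refine .block ?_ ?_ ?_ | refine .add ?_ ?_
    | refine .memCode ?_ ?_ | refine hQ.subst₃ ?_ ?_ ?_ | refine .eq ?_ ?_ | refine .lt ?_ ?_
    | refine .le ?_ ?_ | refine .not ?_ | refine .and ?_ ?_ | refine .bex_le ?_ ?_
    | refine .bex ?_ ?_ | refine .ball ?_ ?_ | refine .ball_le ?_ ?_ | refine .imp ?_ ?_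

/-- The graph in which blocks lose the extension property when `Q` holds throughout. -/
def blockGraph (Q : M.Carrier → M.Carrier → M.Carrier → Prop)
    (hQ : Delta0 fun v => Q (v 0) (v 1) (v 2)) : M.Graph where
  V := {_n | True}
  E := {e | ∃ x, x ≤ e ∧ ∃ y, y ≤ e ∧ e = pair x y ∧ (LowAdj Q x y ∨ LowAdj Q y x)}
  V_mem := setOf_mem_sets (.const True)
  E_mem := by
    refine setOf_mem_sets ?_
    repeat' first
      | exact .var _ | refine .pair ?_ ?_ | refine .lowAdj hQ ?_ ?_ | refine .eq ?_ ?_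
      | refine .or ?_ ?_ | refine .and ?_ ?_ | refine .bex_le ?_ ?_
  nonempty := ⟨0, trivial⟩
  E_sub := by
    rintro e ⟨x, -, y, -, rfl, -⟩
    exact ⟨x, trivial, y, trivial, rfl⟩
  irrefl := by
    rintro x ⟨x', -, y', -, h, h' | h'⟩ <;> obtain ⟨rfl, rfl⟩ := pair_inj.1 h <;>
    exact lt_irrefl _ h'.1
  symm := by
    rintro x y ⟨x', -, y', -, h, h'⟩
    obtain ⟨rfl, rfl⟩ := pair_inj.1 h
    exact ⟨y, left_le_pair _ _, x, right_le_pair _ _, rfl, h'.symm⟩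

section blockGraph

variable {Q : M.Carrier → M.Carrier → M.Carrier → Prop}
  {hQ : Delta0 fun v => Q (v 0) (v 1) (v 2)}

theorem blockGraph_adj {x y : M.Carrier} :
    (blockGraph Q hQ).Adj x y ↔ LowAdj Q x y ∨ LowAdj Q y x := by
  constructor
  · rintro ⟨x', -, y', -, h, h'⟩
    obtain ⟨rfl, rfl⟩ := pair_inj.1 h
    exact h'
  · exact fun h => ⟨x, left_le_pair _ _, y, right_le_pair _ _, rfl, h⟩

/-- The witness is `w + w + 1` for a code `w` of `A` so large that the vertex exceeds all of `A`,
all of `B` and a common bound on the counterexamples for blocks inside `A`. -/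
theorem blockGraph_hasExtension {A B : Set M.Carrier} (hA : A ∈ M.sets) (hAf : IsFinite A)
    (hBf : IsFinite B) (hAB : Disjoint A B)
    (h : ∀ m x, (∀ i, i < m + 1 → block m x i ∈ A) → ∃ y, ¬ Q m x y) :
    (blockGraph Q hQ).HasExtension A B := by
  obtain ⟨k, hk⟩ := hAf
  obtain ⟨l, hl⟩ := hBf
  have h0 : ∀ m : M.Carrier, 0 < m + 1 := fun m => lt_add_one_iff'.2 (zero_le' m)
  have hcol := collection (Q := fun e y => ∀ m, m ≤ e → ∀ x, x ≤ e → e = pair m x →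
    (∀ i, i < m + 1 → block m x i ∈ A) → ¬ Q m x y) ?_ k ?_
  · obtain ⟨Y, hY⟩ := hcol
    obtain ⟨w, hw, hmem⟩ := exists_code (P := fun u => u ∈ A) (.mem hA (.var 0)) k (k + l + Y)
    have hwA : ∀ u, MemCode u w ↔ u ∈ A := fun u =>
      (hmem u).trans ⟨fun h => h.2, fun h => ⟨hk u h, h⟩⟩
    have hwz := lt_double_succ w
    have hkz : k ≤ w + w + 1 := (le_self_add.trans (le_self_add.trans hw)).trans hwz.le
    have hlz : l ≤ w + w + 1 := (le_add_self.trans (le_self_add.trans hw)).trans hwz.le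
    have hYz : Y ≤ w + w + 1 := (le_add_self.trans hw).trans hwz.le
    refine ⟨w + w + 1, trivial, ?_, fun a ha => ?_, fun b hb => ?_⟩
    · rintro (h' | h')
      exacts [(hk _ h').not_ge hkz, (hl _ h').not_ge hlz]
    · refine blockGraph_adj.2 (Or.inr ⟨(hk _ ha).trans_le hkz, w, hwz.le, rfl, (hwA a).2 ha, ?_⟩)
      intro m _ x _ hmx
      have hmx' : ∀ i, i < m + 1 → block m x i ∈ A := fun i hi => (hwA _).1 (hmx i hi)
      -- The element with index 0 bounds `pair m x` below `k`; this is where blocks of size `m + 1`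
      -- are needed, since an empty block would bound nothing.
      obtain ⟨y, hy, hy'⟩ := hY (pair m x)
        ((pair_le_block m x 0).trans_lt (hk _ (hmx' 0 (h0 m))))
      exact ⟨y, hy.trans_le hYz, hy' m (left_le_pair _ _) x (right_le_pair _ _) rfl hmx'⟩
    · rw [blockGraph_adj]
      rintro (h' | ⟨-, w', -, h', hbw, -⟩)
      · exact (h'.1.trans (hl _ hb)).not_ge hlz
      · obtain rfl := double_succ_inj h'
        exact Set.disjoint_left.1 hAB ((hwA b).1 hbw) hb
  · repeat' first
      | exact .var _ | exact .const _ | refine .block ?_ ?_ ?_ | refine .pair ?_ ?_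
      | refine .add ?_ ?_ | refine .mem hA ?_ | refine hQ.subst₃ ?_ ?_ ?_
      | refine .eq ?_ ?_ | refine .lt ?_ ?_ | refine .not ?_
      | refine .ball ?_ ?_ | refine .ball_le ?_ ?_ | refine .imp ?_ ?_
  · intro e _
    by_cases he : ∃ m x, e = pair m x ∧ ∀ i, i < m + 1 → block m x i ∈ A
    · obtain ⟨m, x, rfl, hmx⟩ := he
      obtain ⟨y, hy⟩ := h m x hmx
      refine ⟨y, fun m' _ x' _ h' _ => ?_⟩
      obtain ⟨rfl, rfl⟩ := pair_inj.1 h'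
      exact hy
    · exact ⟨0, fun m _ x _ h₁ h₂ => (he ⟨m, x, h₁, h₂⟩).elim⟩

theorem hasCard_empty : HasCard (∅ : Set M.Carrier) 0 := by
  have h : {_n : M.Carrier | False} ∈ M.sets := setOf_mem_sets (.const False)
  rw [Set.ofPred_false] at h
  refine ⟨⟨0, by simp⟩, ∅, h, by simp, by simp, fun y hy => ?_⟩
  exact (not_lt_zero (show y < 0 from hy)).elim

theorem hasCard_block (m x n : M.Carrier) :
    HasCard {u | ∃ i, i < n ∧ u = block m x i} n := by
  refine ⟨⟨block m x n + 1, ?_⟩, {e | ∃ i, i < n ∧ e = pair (block m x i) i}, ?_, ?_, ?_, ?_⟩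
  · rintro _ ⟨i, hi, rfl⟩
    have := pair_mono (le_refl (pair m x)) hi.le
    exact lt_add_one_iff'.2 (add_le_add this this)
  · refine setOf_mem_sets ?_
    repeat' first
      | exact .var _ | exact .const _ | refine .block ?_ ?_ ?_
      | refine .pair ?_ ?_ | refine .eq ?_ ?_ | refine .and ?_ ?_ | refine .bex ?_ ?_
  · rintro _ ⟨i, hi, rfl⟩
    exact ⟨_, ⟨i, hi, rfl⟩, i, hi, rfl⟩
  · rintro _ ⟨i, hi, rfl⟩
    refine ⟨i, ⟨i, hi, rfl⟩, ?_⟩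
    rintro j ⟨i', -, h⟩
    obtain ⟨h₁, rfl⟩ := pair_inj.1 h
    exact (block_inj h₁).symm
  · intro i hi
    refine ⟨block m x i, ⟨i, hi, rfl⟩, ?_⟩
    rintro u ⟨i', -, h⟩
    obtain ⟨h₁, rfl⟩ := pair_inj.1 h
    exact h₁

/-- The failing pair is the block of `(m, x)` with the empty set: a common neighbour would have to
supply a counterexample to `Q`. -/
theorem blockGraph_extensionFails {m x : M.Carrier} (h : ∀ y, Q m x y) :
    (blockGraph Q hQ).ExtensionFails (m + 1) := by
  have h0 : 0 < m + 1 := lt_add_one_iff'.2 (zero_le' m)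
  refine ⟨{u | ∃ i, i < m + 1 ∧ u = block m x i}, ∅, ⟨?_, ?_, fun _ _ => trivial,
    fun _ _ => trivial, Set.disjoint_empty _, m + 1, 0, hasCard_block m x _, hasCard_empty,
    add_zero _⟩, ?_⟩
  · refine setOf_mem_sets ?_
    repeat' first
      | exact .var _ | exact .const _ | refine .block ?_ ?_ ?_ | refine .eq ?_ ?_
      | refine .and ?_ ?_ | refine .bex ?_ ?_
  · have h : {_n : M.Carrier | False} ∈ M.sets := setOf_mem_sets (.const False)
    rwa [Set.ofPred_false] at h
  · rintro ⟨z, -, -, hz, -⟩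
    have key : ∀ i, i < m + 1 → LowAdj Q (block m x i) z := by
      intro i hi
      -- Upper ends of edges are odd and block elements are even, so `z` is the upper end.
      rcases blockGraph_adj.1 (hz _ ⟨i, hi, rfl⟩) with h' | h'
      · obtain ⟨-, w, -, hw, -⟩ := h'
        exact (double_ne_double_succ _ _ hw).elim
      · exact h'
    obtain ⟨hlt, w, hwz, rfl, hw, hall⟩ := key 0 h0
    obtain ⟨y, -, hy⟩ := hall m (((left_le_pair _ _).trans (pair_le_block m x 0)).trans hlt.le)
      x (((right_le_pair _ _).trans (pair_le_block m x 0)).trans hlt.le) fun i hi => by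
        obtain ⟨-, w', -, h', hw', -⟩ := key i hi
        rwa [double_succ_inj h']
    exact hy (h y)

/-- Some block inside `A` has no counterexample, as otherwise the pair has a witness. The counting
bijection of `A` injects its `m + 1` elements into the numbers below `a`, so `m < a ≤ n`. -/
theorem exists_of_blockGraph_extensionFails {n : M.Carrier}
    (h : (blockGraph Q hQ).ExtensionFails n) : ∃ m, m < n ∧ ∃ x, ∀ y, Q m x y := by
  obtain ⟨A, B, ⟨hA, hB, -, -, hAB, a, b, ⟨hAf, f, hf, hf₀, hf₁, hf₂⟩, ⟨hBf, -⟩, rfl⟩, h⟩ := h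
  by_contra! hP
  refine h (blockGraph_hasExtension hA hAf hBf hAB fun m x hmx => hP m ?_ x)
  refine lt_of_lt_of_le (add_one_le_iff'.1 ?_) (le_self_add : a ≤ a + b)
  refine pigeonhole (R := fun i y => y < a ∧ pair (block m x i) y ∈ f) ?_ (fun i hi => ?_)
    fun i hi i' hi' y hy h h' => ?_
  · repeat' first
      | exact .var _ | exact .const _ | refine .block ?_ ?_ ?_ | refine .pair ?_ ?_
      | refine .mem hf ?_ | refine .lt ?_ ?_ | refine .and ?_ ?_
  · obtain ⟨y, hy, -⟩ := hf₁ _ (hmx i hi)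
    have hya : y < a := by
      obtain ⟨x', -, y', hy', he⟩ := hf₀ _ hy
      obtain ⟨-, rfl⟩ := pair_inj.1 he
      exact hy'
    exact ⟨y, hya, hya, hy⟩
  · exact block_inj ((hf₂ y hy).unique h.2 h'.2)

end blockGraph

/-! ### Isomorphism invariance, existence of a random graph, and the first implication -/

theorem Graph.IsRandom.of_iso {G R : M.Graph} (hR : R.IsRandom) (h : G.Iso R) : G.IsRandom := by
  obtain ⟨f, hf, ⟨hf₀, hf₁, hf₂⟩, hadj⟩ := h
  have hmaps : ∀ {x y}, pair x y ∈ f → x ∈ G.V ∧ y ∈ R.V := by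
    intro x y h
    obtain ⟨x', hx', y', hy', he⟩ := hf₀ _ h
    obtain ⟨rfl, rfl⟩ := pair_inj.1 he
    exact ⟨hx', hy'⟩
  have image : ∀ A ∈ M.sets, IsFinite A → A ⊆ G.V → ∃ A' ∈ M.sets, IsFinite A' ∧
      A' ⊆ R.V ∧ ∀ y, y ∈ A' ↔ ∃ x, x ∈ A ∧ pair x y ∈ f := by
    rintro A hA ⟨k, hk⟩ hAV
    refine ⟨{y | ∃ x, x < k ∧ x ∈ A ∧ pair x y ∈ f}, setOf_mem_sets ?_, ?_, ?_, fun y => ?_⟩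
    · repeat' first
        | exact .var _ | exact .const _ | refine .pair ?_ ?_
        | refine .mem hf ?_ | refine .mem hA ?_ | refine .and ?_ ?_ | refine .bex ?_ ?_
    -- Boundedness of the image of a bounded set is an instance of collection.
    · have hcol := collection (Q := fun x y => x ∈ A → pair x y ∈ f) ?_ k fun x _ => ?_
      · obtain ⟨z, hz⟩ := hcol
        refine ⟨z, ?_⟩
        rintro y ⟨x, hx, hxA, hxy⟩
        obtain ⟨y', hy', h⟩ := hz x hx
        rwa [(hf₁ x (hAV hxA)).unique hxy (h hxA)]
      · repeat' first
          | exact .var _ | refine .pair ?_ ?_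
          | refine .mem hf ?_ | refine .mem hA ?_ | refine .imp ?_ ?_
      · by_cases hx : x ∈ A
        · obtain ⟨y, hy, -⟩ := hf₁ x (hAV hx)
          exact ⟨y, fun _ => hy⟩
        · exact ⟨0, fun h => (hx h).elim⟩
    · rintro y ⟨x, -, -, h⟩
      exact (hmaps h).2
    · exact ⟨fun ⟨x, _, h⟩ => ⟨x, h⟩, fun ⟨x, h⟩ => ⟨x, hk x h.1, h⟩⟩
  intro A hA B hB hAf hBf hAV hBV hAB
  obtain ⟨A', hA', hAf', hAV', hAA'⟩ := image A hA hAf hAV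
  obtain ⟨B', hB', hBf', hBV', hBB'⟩ := image B hB hBf hBV
  have hdisj : Disjoint A' B' := by
    refine Set.disjoint_left.2 fun y hy hy' => ?_
    obtain ⟨x, hx, hxy⟩ := (hAA' y).1 hy
    obtain ⟨x', hx', hxy'⟩ := (hBB' y).1 hy'
    rw [(hf₂ y (hAV' hy)).unique hxy hxy'] at hx
    exact Set.disjoint_left.1 hAB hx hx'
  obtain ⟨y, hyV, hy, hyA, hyB⟩ := hR A' hA' B' hB' hAf' hBf' hAV' hBV' hdisj
  obtain ⟨x, hxy, -⟩ := hf₂ y hyV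
  refine ⟨x, (hmaps hxy).1, ?_, fun a ha => ?_, fun b hb h => ?_⟩
  · rintro (h | h)
    · exact hy (Or.inl ((hAA' y).2 ⟨x, h, hxy⟩))
    · exact hy (Or.inr ((hBB' y).2 ⟨x, h, hxy⟩))
  · obtain ⟨c, hc, -⟩ := hf₁ a (hAV ha)
    exact (hadj x a y c hxy hc).2 (hyA c ((hAA' c).2 ⟨a, ha, hc⟩))
  · obtain ⟨c, hc, -⟩ := hf₁ b (hBV hb)
    exact hyB c ((hBB' c).2 ⟨b, hb, hc⟩) ((hadj x b y c hxy hc).1 h)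

/-- With `Q` false every block has the counterexample 0, so no pair is obstructed. -/
theorem exists_isRandom : ∃ R : M.Graph, R.IsRandom :=
  ⟨blockGraph (fun _ _ _ => False) (.const False), fun _ hA _ _ hAf hBf _ _ hAB =>
    blockGraph_hasExtension hA hAf hBf hAB fun _ _ _ => ⟨0, id⟩⟩

theorem LeastExtensionFailure.leastSigma2 (h : M.LeastExtensionFailure) : M.LeastSigma2 := by
  rintro P hP ⟨m, hm⟩
  obtain ⟨Q, hQ, hPQ⟩ := hP.exists_delta0
  obtain ⟨R, hR⟩ := exists_isRandom (M := M)
  have fails : ∀ m, P m → (blockGraph Q hQ).ExtensionFails (m + 1) := by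
    intro m hm
    obtain ⟨x, hx⟩ := (hPQ m).1 hm
    exact blockGraph_extensionFails hx
  obtain ⟨n, hn, hmin⟩ := h R hR (blockGraph Q hQ) fun hiso =>
    (hR.of_iso hiso).not_extensionFails _ (fails m hm)
  obtain ⟨k, hkn, hk⟩ := exists_of_blockGraph_extensionFails hn
  -- A smaller `j` with `P j` would give a failure of size `j + 1 ≤ k < n`.
  refine ⟨k, (hPQ k).2 hk, fun j hj hPj => hmin (j + 1) ?_ (fails j hPj)⟩
  exact (add_one_le_iff'.2 hj).trans_lt hkn

/-! ## Cardinalities of finite sets -/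

theorem MemCode.left_lt {x y c : M.Carrier} (h : MemCode (pair x y) c) : x < c :=
  (left_le_pair x y).trans_lt h.lt

theorem MemCode.right_lt {x y c : M.Carrier} (h : MemCode (pair x y) c) : y < c :=
  (right_le_pair x y).trans_lt h.lt

theorem exists_code_of_isFinite {X : Set M.Carrier} (hX : X ∈ M.sets) (hf : IsFinite X) :
    ∃ A, ∀ u, MemCode u A ↔ u ∈ X := by
  obtain ⟨k, hk⟩ := hf
  obtain ⟨A, -, hA⟩ := exists_code (P := fun u => u ∈ X) (.mem hX (.var 0)) k 0
  exact ⟨A, fun u => (hA u).trans ⟨fun h => h.2, fun h => ⟨hk u h, h⟩⟩⟩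

/-- `c` codes a bijection from the part below `k` of the set coded by `A` onto `{0, …, n - 1}`. -/
def BijCode (c A k n : M.Carrier) : Prop :=
  (∀ x, x < k → MemCode x A → ∃ y, y < n ∧ MemCode (pair x y) c) ∧
  (∀ y, y < n → ∃ x, x < k ∧ MemCode x A ∧ MemCode (pair x y) c) ∧
  ∀ x, x < k → MemCode x A → ∀ x', x' < k → MemCode x' A → ∀ y, y < n → ∀ y', y' < n →
    MemCode (pair x y) c → MemCode (pair x' y') c → (x = x' ↔ y = y')

theorem Delta0.bijCode {r s t q : (ℕ → M.Carrier) → M.Carrier} (hr : IsTerm r) (hs : IsTerm s)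
    (ht : IsTerm t) (hq : IsTerm q) : Delta0 fun v => BijCode (r v) (s v) (t v) (q v) := by
  refine Delta0.subst₄ ?_ hr hs ht hq
  unfold BijCode
  repeat' first
    | exact .var _ | refine .pair ?_ ?_ | refine .memCode ?_ ?_ | refine .eq ?_ ?_
    | refine .lt ?_ ?_ | refine .and ?_ ?_ | refine .bex ?_ ?_ | refine .ball ?_ ?_
    | refine .iff ?_ ?_ | refine .imp ?_ ?_

theorem BijCode.hasCard {c A k n : M.Carrier} (h : BijCode c A k n) :
    HasCard {x | x < k ∧ MemCode x A} n := by
  obtain ⟨h₁, h₂, h₃⟩ := h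
  refine ⟨⟨k, fun x hx => hx.1⟩, {e | ∃ x, x < k ∧ ∃ y, y < n ∧ e = pair x y ∧ MemCode x A ∧
    MemCode (pair x y) c}, setOf_mem_sets ?_, ?_, ?_, ?_⟩
  · repeat' first
      | exact .var _ | exact .const _ | refine .pair ?_ ?_ | refine .memCode ?_ ?_
      | refine .eq ?_ ?_ | refine .and ?_ ?_ | refine .bex ?_ ?_
  · rintro _ ⟨x, hx, y, hy, rfl, hxA, -⟩
    exact ⟨x, ⟨hx, hxA⟩, y, hy, rfl⟩
  · rintro x ⟨hx, hxA⟩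
    obtain ⟨y, hy, hxy⟩ := h₁ x hx hxA
    refine ⟨y, ⟨x, hx, y, hy, rfl, hxA, hxy⟩, ?_⟩
    rintro y' ⟨x', -, y'', hy', h, -, hxy'⟩
    obtain ⟨rfl, rfl⟩ := pair_inj.1 h
    exact (h₃ x hx hxA x hx hxA y' hy' y hy hxy' hxy).1 rfl
  · intro y hy
    obtain ⟨x, hx, hxA, hxy⟩ := h₂ y hy
    refine ⟨x, ⟨x, hx, y, hy, rfl, hxA, hxy⟩, ?_⟩
    rintro x' ⟨x'', hx', y', -, h, hxA', hxy'⟩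
    obtain ⟨rfl, rfl⟩ := pair_inj.1 h
    exact (h₃ x' hx' hxA' x hx hxA y hy y hy hxy' hxy).2 rfl

/-- Members of a coded set lie below its code, so the bijection lives below `A` and `n` and is
itself coded. -/
theorem HasCard.exists_bijCode {X : Set M.Carrier} {A n : M.Carrier} (h : HasCard X n)
    (hA : ∀ u, MemCode u A ↔ u ∈ X) : ∃ c, BijCode c A A n := by
  obtain ⟨-, f, hf, hf₀, hf₁, hf₂⟩ := h
  obtain ⟨c, hc⟩ := exists_rel_code (R := fun x y => pair x y ∈ f)
    (.mem hf (.pair (.var 0) (.var 1))) A n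
  refine ⟨c, fun x hx hxA => ?_, fun y hy => ?_, ?_⟩
  · obtain ⟨y, hxy, -⟩ := hf₁ x ((hA x).1 hxA)
    obtain ⟨x', -, y', hy', h⟩ := hf₀ _ hxy
    obtain ⟨rfl, rfl⟩ := pair_inj.1 h
    exact ⟨y, hy', (hc _ _).2 ⟨hx, hy', hxy⟩⟩
  · obtain ⟨x, hxy, -⟩ := hf₂ y hy
    obtain ⟨x', hx', y', -, h⟩ := hf₀ _ hxy
    obtain ⟨rfl, rfl⟩ := pair_inj.1 h
    have hxA := (hA x).2 hx'
    exact ⟨x, hxA.lt, hxA, (hc _ _).2 ⟨hxA.lt, hy, hxy⟩⟩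
  · intro x _ hxA x' _ hxA' y hy y' hy' h h'
    have h := ((hc _ _).1 h).2.2
    have h' := ((hc _ _).1 h').2.2
    constructor
    · rintro rfl
      exact (hf₁ x ((hA x).1 hxA)).unique h h'
    · rintro rfl
      exact (hf₂ y hy).unique h h'

/-- Induction on the cut-off `k`: if `k` belongs to the set, the pair `(k, n)` is added to the
bijection; otherwise nothing changes. -/
theorem exists_bijCode (A k : M.Carrier) : ∃ n c, BijCode c A k n := by
  have key := sigma1_induction
    (Q := fun z k => ∃ n, n ≤ z ∧ ∃ c, c ≤ z ∧ BijCode c A k n) ?_ ?_ ?_ k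
  · obtain ⟨z, n, -, c, -, h⟩ := key
    exact ⟨n, c, h⟩
  · repeat' first
      | exact .var _ | exact .const _ | refine .bijCode ?_ ?_ ?_ ?_ | refine .bex_le ?_ ?_
  · exact ⟨0, 0, le_rfl, 0, le_rfl, fun x hx => (not_lt_zero hx).elim,
      fun y hy => (not_lt_zero hy).elim, fun x hx => (not_lt_zero hx).elim⟩
  · rintro k ⟨-, n, -, c, -, h₁, h₂, h₃⟩
    have hlt : ∀ {x y : M.Carrier}, x < y → x < y + 1 := fun h => lt_add_one_iff'.2 h.le
    have hself : ∀ x : M.Carrier, x < x + 1 := fun x => lt_add_one_iff'.2 le_rfl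
    by_cases hk : MemCode k A
    · have hR : Delta0 fun v : ℕ → M.Carrier =>
          v 0 < k ∧ v 1 < n ∧ MemCode (pair (v 0) (v 1)) c ∨ v 0 = k ∧ v 1 = n := by
        repeat' first
          | exact .var _ | exact .const _ | refine .pair ?_ ?_ | refine .memCode ?_ ?_
          | refine .eq ?_ ?_ | refine .lt ?_ ?_ | refine .and ?_ ?_ | refine .or ?_ ?_
      obtain ⟨c', hc'⟩ := exists_rel_code
        (R := fun x y => x < k ∧ y < n ∧ MemCode (pair x y) c ∨ x = k ∧ y = n) hR (k + 1) (n + 1)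
      refine ⟨n + 1 + c', n + 1, le_self_add, c', le_add_self, fun x hx hxA => ?_,
        fun y hy => ?_, ?_⟩
      · rcases (lt_add_one_iff'.1 hx).eq_or_lt with rfl | hx'
        · exact ⟨n, hself n, (hc' _ _).2 ⟨hx, hself n, Or.inr ⟨rfl, rfl⟩⟩⟩
        · obtain ⟨y, hy, hxy⟩ := h₁ x hx' hxA
          exact ⟨y, hlt hy, (hc' _ _).2 ⟨hx, hlt hy, Or.inl ⟨hx', hy, hxy⟩⟩⟩
      · rcases (lt_add_one_iff'.1 hy).eq_or_lt with rfl | hy'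
        · exact ⟨k, hself k, hk, (hc' _ _).2 ⟨hself k, hy, Or.inr ⟨rfl, rfl⟩⟩⟩
        · obtain ⟨x, hx, hxA, hxy⟩ := h₂ y hy'
          exact ⟨x, hlt hx, hxA, (hc' _ _).2 ⟨hlt hx, hy, Or.inl ⟨hx, hy', hxy⟩⟩⟩
      · intro x _ hxA x' _ hxA' y _ y' _ h h'
        rcases ((hc' _ _).1 h).2.2 with ⟨hx, hy, h⟩ | ⟨rfl, rfl⟩ <;>
        rcases ((hc' _ _).1 h').2.2 with ⟨hx', hy', h'⟩ | ⟨rfl, rfl⟩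
        · exact h₃ x hx hxA x' hx' hxA' y hy y' hy' h h'
        · exact ⟨fun h => (hx.ne h).elim, fun h => (hy.ne h).elim⟩
        · exact ⟨fun h => (hx'.ne' h).elim, fun h => (hy'.ne' h).elim⟩
        · exact ⟨fun _ => rfl, fun _ => rfl⟩
    · have hlt' : ∀ {x}, x < k + 1 → MemCode x A → x < k := fun {x} hx hxA =>
        lt_of_le_of_ne (lt_add_one_iff'.1 hx) (by rintro rfl; exact hk hxA)
      refine ⟨n + c, n, le_self_add, c, le_add_self, fun x hx hxA => h₁ x (hlt' hx hxA) hxA,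
        fun y hy => ?_, ?_⟩
      · obtain ⟨x, hx, h⟩ := h₂ y hy
        exact ⟨x, hlt hx, h⟩
      · intro x hx hxA x' hx' hxA'
        exact h₃ x (hlt' hx hxA) hxA x' (hlt' hx' hxA') hxA'

theorem exists_hasCard {X : Set M.Carrier} (hX : X ∈ M.sets) (hf : IsFinite X) :
    ∃ n, HasCard X n := by
  obtain ⟨A, hA⟩ := exists_code_of_isFinite hX hf
  obtain ⟨n, c, h⟩ := exists_bijCode A A
  refine ⟨n, ?_⟩
  have h := h.hasCard
  have hXA : {x | x < A ∧ MemCode x A} = X := by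
    ext u
    exact ⟨fun h => (hA u).1 h.2, fun h => ⟨((hA u).2 h).lt, (hA u).2 h⟩⟩
  rwa [hXA] at h

/-! ## The complexity of failures of the extension property -/

namespace Graph

/-- The codes `A`, `B` of finite sets, with coded bijections `c`, `d`, give an `n`-extension pair
to which the vertex `z` does not testify. -/
def FailsAt (G : M.Graph) (n A B a b c d z : M.Carrier) : Prop :=
  (∀ u, u < A → MemCode u A → u ∈ G.V ∧ ¬ MemCode u B) ∧
  (∀ u, u < B → MemCode u B → u ∈ G.V) ∧
  BijCode c A A a ∧ BijCode d B B b ∧ a + b = n ∧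
  ¬ (z ∈ G.V ∧ ¬ MemCode z A ∧ ¬ MemCode z B ∧ (∀ u, u < A → MemCode u A → pair z u ∈ G.E) ∧
    ∀ u, u < B → MemCode u B → ¬ pair z u ∈ G.E)

/-- Trades the quantifiers over finite sets and bijections for quantifiers over their codes. -/
theorem extensionFails_iff (G : M.Graph) (n : M.Carrier) :
    G.ExtensionFails n ↔ ∃ A B a b c d, ∀ z, G.FailsAt n A B a b c d z := by
  constructor
  · rintro ⟨X, Y, ⟨hX, hY, hXV, hYV, hXY, a, b, ha, hb, hab⟩, h⟩
    obtain ⟨A, hA⟩ := exists_code_of_isFinite hX ha.1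
    obtain ⟨B, hB⟩ := exists_code_of_isFinite hY hb.1
    obtain ⟨c, hc⟩ := ha.exists_bijCode hA
    obtain ⟨d, hd⟩ := hb.exists_bijCode hB
    refine ⟨A, B, a, b, c, d, fun z => ⟨fun u _ hu => ⟨hXV ((hA u).1 hu), fun hu' => ?_⟩,
      fun u _ hu => hYV ((hB u).1 hu), hc, hd, hab, ?_⟩⟩
    · exact Set.disjoint_left.1 hXY ((hA u).1 hu) ((hB u).1 hu')
    · rintro ⟨hz, hzA, hzB, h₁, h₂⟩
      refine h ⟨z, hz, ?_, fun u hu => h₁ u ((hA u).2 hu).lt ((hA u).2 hu),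
        fun u hu => h₂ u ((hB u).2 hu).lt ((hB u).2 hu)⟩
      rintro (h | h)
      exacts [hzA ((hA z).2 h), hzB ((hB z).2 h)]
  · rintro ⟨A, B, a, b, c, d, h⟩
    -- Only the last clause depends on `z`, so any instance supplies the others.
    obtain ⟨hAV, hBV, hc, hd, hab, -⟩ := h 0
    have sets : ∀ A : M.Carrier, {x | x < A ∧ MemCode x A} ∈ M.sets := fun A =>
      setOf_mem_sets (.and (.lt (.var 0) (.const A)) (.memCode (.var 0) (.const A)))
    refine ⟨_, _, ⟨sets A, sets B, fun u hu => (hAV u hu.1 hu.2).1, fun u hu => hBV u hu.1 hu.2,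
      Set.disjoint_left.2 fun u hu hu' => (hAV u hu.1 hu.2).2 hu'.2, a, b, hc.hasCard,
      hd.hasCard, hab⟩, ?_⟩
    rintro ⟨z, hz, hzAB, h₁, h₂⟩
    exact (h z).2.2.2.2.2 ⟨hz, fun h => hzAB (Or.inl ⟨h.lt, h⟩),
      fun h => hzAB (Or.inr ⟨h.lt, h⟩), fun u h h' => h₁ u ⟨h, h'⟩, fun u h h' => h₂ u ⟨h, h'⟩⟩

/-- The six existential numbers are packed into one number `t`, which is unpacked by bounded
quantifiers after the universal one. -/
theorem isSigma2_extensionFails (G : M.Graph) : M.IsSigma2 G.ExtensionFails := by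
  have key : ∀ n, G.ExtensionFails n ↔ ∃ t, ∀ z, ∃ A, A ≤ t ∧ ∃ B, B ≤ t ∧ ∃ a, a ≤ t ∧
      ∃ b, b ≤ t ∧ ∃ c, c ≤ t ∧ ∃ d, d ≤ t ∧
        t = pair (pair (pair A B) (pair a b)) (pair c d) ∧ G.FailsAt n A B a b c d z := by
    intro n
    rw [extensionFails_iff]
    constructor
    · rintro ⟨A, B, a, b, c, d, h⟩
      have h₁ := left_le_pair (pair (pair A B) (pair a b)) (pair c d)
      have h₂ := right_le_pair (pair (pair A B) (pair a b)) (pair c d)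
      have h₃ := (left_le_pair (pair A B) (pair a b)).trans h₁
      have h₄ := (right_le_pair (pair A B) (pair a b)).trans h₁
      exact ⟨pair (pair (pair A B) (pair a b)) (pair c d), fun z =>
        ⟨A, (left_le_pair _ _).trans h₃, B, (right_le_pair _ _).trans h₃,
          a, (left_le_pair _ _).trans h₄, b, (right_le_pair _ _).trans h₄,
          c, (left_le_pair _ _).trans h₂, d, (right_le_pair _ _).trans h₂, rfl, h z⟩⟩
    · rintro ⟨t, h⟩
      obtain ⟨A, -, B, -, a, -, b, -, c, -, d, -, rfl, -⟩ := h 0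
      refine ⟨A, B, a, b, c, d, fun z => ?_⟩
      -- The components found for different `z` agree because pairing is injective.
      obtain ⟨A', -, B', -, a', -, b', -, c', -, d', -, h, h'⟩ := h z
      simp only [pair_inj] at h
      obtain ⟨⟨⟨rfl, rfl⟩, rfl, rfl⟩, rfl, rfl⟩ := h
      exact h'
  rw [show G.ExtensionFails = _ from funext fun n => propext (key n)]
  refine Delta0.isSigma2 (Q := fun z t n => ∃ A, A ≤ t ∧ ∃ B, B ≤ t ∧ ∃ a, a ≤ t ∧
      ∃ b, b ≤ t ∧ ∃ c, c ≤ t ∧ ∃ d, d ≤ t ∧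
        t = pair (pair (pair A B) (pair a b)) (pair c d) ∧ G.FailsAt n A B a b c d z) ?_
  unfold FailsAt
  repeat' first
    | exact .var _ | refine .pair ?_ ?_ | refine .add ?_ ?_ | refine .memCode ?_ ?_
    | refine .bijCode ?_ ?_ ?_ ?_ | refine .mem G.V_mem ?_ | refine .mem G.E_mem ?_
    | refine .eq ?_ ?_ | refine .not ?_ | refine .and ?_ ?_ | refine .bex_le ?_ ?_
    | refine .ball ?_ ?_ | refine .imp ?_ ?_

theorem exists_extensionFails {G : M.Graph} (hG : ¬ G.IsRandom) : ∃ n, G.ExtensionFails n := by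
  unfold IsRandom at hG
  push Not at hG
  obtain ⟨A, hA, B, hB, hAf, hBf, hAV, hBV, hAB, h⟩ := hG
  obtain ⟨a, ha⟩ := exists_hasCard hA hAf
  obtain ⟨b, hb⟩ := exists_hasCard hB hBf
  exact ⟨a + b, A, B, ⟨hA, hB, hAV, hBV, hAB, a, b, ha, hb, rfl⟩, h⟩

end Graph

/-! ## Recursion along a relation -/

/-- `y'` is the least number with `S i y y'`. -/
def LeastStep (S : M.Carrier → M.Carrier → M.Carrier → Prop) (i y y' : M.Carrier) : Prop :=
  S i y y' ∧ ∀ z, z < y' → ¬ S i y z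

theorem LeastStep.unique {S : M.Carrier → M.Carrier → M.Carrier → Prop}
    {i y a b : M.Carrier} (ha : LeastStep S i y a) (hb : LeastStep S i y b) : a = b := by
  rcases lt_trichotomy a b with h | h | h
  exacts [(hb.2 a h ha.1).elim, h, (ha.2 b h hb.1).elim]

/-- `s` codes a sequence of length `n + 1` that starts with `p` and follows `S`. -/
def IsRun (S : M.Carrier → M.Carrier → M.Carrier → Prop) (p s n : M.Carrier) : Prop :=
  (∀ i, i ≤ n → ∃ y, y < s ∧ MemCode (pair i y) s) ∧
  (∀ y, y < s → MemCode (pair 0 y) s → y = p) ∧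
  ∀ i, i < n → ∀ y, y < s → ∀ y', y' < s → MemCode (pair i y) s → MemCode (pair (i + 1) y') s →
    LeastStep S i y y'

section recursion

variable {S : M.Carrier → M.Carrier → M.Carrier → Prop} {p : M.Carrier}

theorem Delta0.isRun (hS : Delta0 fun v => S (v 0) (v 1) (v 2))
    {s t : (ℕ → M.Carrier) → M.Carrier} (hs : IsTerm s) (ht : IsTerm t) :
    Delta0 fun v => IsRun S p (s v) (t v) := by
  refine Delta0.subst₂ ?_ hs ht
  unfold IsRun LeastStep
  repeat' first
    | exact .var _ | exact .const _ | refine .pair ?_ ?_ | refine .add ?_ ?_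
    | refine .memCode ?_ ?_ | refine hS.subst₃ ?_ ?_ ?_ | refine .eq ?_ ?_
    | refine .not ?_ | refine .and ?_ ?_ | refine .bex ?_ ?_ | refine .ball ?_ ?_
    | refine .ball_le ?_ ?_ | refine .imp ?_ ?_

/-- Least steps are deterministic. With `s = s'` this shows that a run is single-valued, which
`IsRun` does not demand. -/
theorem IsRun.unique {s s' n n' : M.Carrier} (h : IsRun S p s n) (h' : IsRun S p s' n')
    (i : M.Carrier) : i ≤ n → i ≤ n' → ∀ y, y < s → ∀ y', y' < s' →
      MemCode (pair i y) s → MemCode (pair i y') s' → y = y' := by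
  refine delta0_induction (P := fun i => i ≤ n → i ≤ n' → ∀ y, y < s → ∀ y', y' < s' →
      MemCode (pair i y) s → MemCode (pair i y') s' → y = y') ?_ ?_ (fun i ih => ?_) i
  · repeat' first
      | exact .var _ | exact .const _ | refine .pair ?_ ?_ | refine .memCode ?_ ?_
      | refine .eq ?_ ?_ | refine .le ?_ ?_ | refine .ball ?_ ?_ | refine .imp ?_ ?_
  · intro _ _ y hy y' hy' hm hm'
    rw [h.2.1 y hy hm, h'.2.1 y' hy' hm']
  · intro hn hn' y hy y' hy' hm hm'
    have hi := add_one_le_iff'.1 hn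
    have hi' := add_one_le_iff'.1 hn'
    obtain ⟨z, hz, hzm⟩ := h.1 i hi.le
    obtain ⟨z', hz', hzm'⟩ := h'.1 i hi'.le
    obtain rfl := ih hi.le hi'.le z hz z' hz' hzm hzm'
    exact (h.2.2 i hi z hz y hy hzm hm).unique (h'.2.2 i hi' z hz' y' hy' hzm' hm')

theorem exists_isRun (hS : Delta0 fun v => S (v 0) (v 1) (v 2))
    (htot : ∀ i y, ∃ y', S i y y') (n : M.Carrier) : ∃ s, IsRun S p s n := by
  have hself : ∀ x : M.Carrier, x < x + 1 := fun x => lt_add_one_iff'.2 le_rfl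
  refine sigma1_induction (Q := fun s n => IsRun S p s n) (.isRun hS (.var 0) (.var 1)) ?_ ?_ n
  · obtain ⟨s, hs⟩ := exists_rel_code (R := fun x y : M.Carrier => x = 0 ∧ y = p)
      (.and (.eq (.var 0) (.const _)) (.eq (.var 1) (.const _))) (0 + 1) (p + 1)
    refine ⟨s, fun i hi => ?_, fun y _ hm => ((hs _ _).1 hm).2.2.2,
      fun i hi => (not_lt_zero hi).elim⟩
    obtain rfl := le_antisymm hi (zero_le' i)
    have hm : MemCode (pair 0 p) s := (hs _ _).2 ⟨hself 0, hself p, rfl, rfl⟩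
    exact ⟨p, hm.right_lt, hm⟩
  · rintro n ⟨s, h₁, h₂, h₃⟩
    obtain ⟨y, hy, hys⟩ := h₁ n le_rfl
    obtain ⟨y₁, hy₁⟩ := htot n y
    obtain ⟨y', hy', hmin⟩ := delta0_least (P := fun y' => S n y y')
      (hS.subst₃ (.const n) (.const y) (.var 0)) hy₁
    have hR : Delta0 fun v : ℕ → M.Carrier =>
        v 0 ≤ n ∧ MemCode (pair (v 0) (v 1)) s ∨ v 0 = n + 1 ∧ v 1 = y' := by
      repeat' first
        | exact .var _ | exact .const _ | refine .pair ?_ ?_ | refine .memCode ?_ ?_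
        | refine .eq ?_ ?_ | refine .le ?_ ?_ | refine .and ?_ ?_ | refine .or ?_ ?_
    obtain ⟨s', hs'⟩ := exists_rel_code
      (R := fun x z => x ≤ n ∧ MemCode (pair x z) s ∨ x = n + 1 ∧ z = y') hR (n + 1 + 1)
      (s + y' + 1)
    have hold : ∀ i z, i ≤ n → (MemCode (pair i z) s' ↔ MemCode (pair i z) s) := by
      intro i z hi
      rw [hs']
      have hin : i ≠ n + 1 := (lt_add_one_iff'.2 hi).ne
      constructor
      · rintro ⟨-, -, ⟨-, h⟩ | ⟨h, -⟩⟩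
        exacts [h, (hin h).elim]
      · intro h
        exact ⟨(lt_add_one_iff'.2 hi).trans (hself _),
          lt_add_one_iff'.2 (h.right_lt.le.trans le_self_add), Or.inl ⟨hi, h⟩⟩
    have hnew : ∀ z, MemCode (pair (n + 1) z) s' ↔ z = y' := by
      intro z
      rw [hs']
      constructor
      · rintro ⟨-, -, ⟨h, -⟩ | ⟨-, h⟩⟩
        exacts [((hself n).not_ge h).elim, h]
      · rintro rfl
        exact ⟨hself _, lt_add_one_iff'.2 le_add_self, Or.inr ⟨rfl, rfl⟩⟩
    refine ⟨s', fun i hi => ?_, fun z _ hz => ?_, fun i hi z _ z' _ hz hz' => ?_⟩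
    · rcases hi.eq_or_lt with rfl | hi
      · have := (hnew y').2 rfl
        exact ⟨y', this.right_lt, this⟩
      · obtain ⟨z, hz, hzs⟩ := h₁ i (lt_add_one_iff'.1 hi)
        have := (hold i z (lt_add_one_iff'.1 hi)).2 hzs
        exact ⟨z, this.right_lt, this⟩
    · have hz := (hold 0 z (zero_le' n)).1 hz
      exact h₂ z hz.right_lt hz
    · have hin := lt_add_one_iff'.1 hi
      have hz := (hold i z hin).1 hz
      rcases hin.eq_or_lt with rfl | hin
      · obtain rfl := (hnew z').1 hz'
        obtain rfl : y = z := IsRun.unique ⟨h₁, h₂, h₃⟩ ⟨h₁, h₂, h₃⟩ i le_rfl le_rfl y hy z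
          hz.right_lt hys hz
        exact ⟨hy', hmin⟩
      · have hz' := (hold (i + 1) z' (add_one_le_iff'.2 hin)).1 hz'
        exact h₃ i hin z hz.right_lt z' hz'.right_lt hz hz'

/-- A total `Delta0` relation has an infinite path. -/
theorem exists_path (hS : Delta0 fun v => S (v 0) (v 1) (v 2)) (htot : ∀ i y, ∃ y', S i y y')
    (p : M.Carrier) : ∃ f : M.Carrier → M.Carrier, ∃ F ∈ M.sets,
      (∀ n y, pair n y ∈ F ↔ y = f n) ∧ f 0 = p ∧ ∀ n, S n (f n) (f (n + 1)) := by
  have hex : ∀ n, ∃ y s, IsRun S p s n ∧ MemCode (pair n y) s := by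
    intro n
    obtain ⟨s, hs⟩ := exists_isRun (p := p) hS htot n
    obtain ⟨y, -, hy⟩ := hs.1 n le_rfl
    exact ⟨y, s, hs, hy⟩
  choose f g hg hf using hex
  have huniq : ∀ {n s i y}, IsRun S p s n → i ≤ n → MemCode (pair i y) s → y = f i :=
    fun hs hi hy => hs.unique (hg _) _ hi le_rfl _ hy.right_lt _ (hf _).right_lt hy (hf _)
  -- The path is Δ⁰₁: runs of every length exist and agree, so a value occurs at place `n` of some
  -- run of that length exactly when every such run has only this value there.
  refine ⟨f, {e | ∃ s, ∃ n, n ≤ e ∧ ∃ y, y ≤ e ∧ e = pair n y ∧ IsRun S p s n ∧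
    MemCode (pair n y) s}, setOf_exists_mem_sets (Q' := fun s e => ∃ n, n ≤ e ∧ ∃ y, y ≤ e ∧
      e = pair n y ∧ (IsRun S p s n → ∀ z, z < s → MemCode (pair n z) s → z = y)) ?_ ?_ ?_,
    fun n y => ?_, ?_, fun n => ?_⟩
  · repeat' first
      | exact .var _ | exact .const _ | refine .pair ?_ ?_ | refine .memCode ?_ ?_
      | refine .isRun hS ?_ ?_ | refine .eq ?_ ?_ | refine .and ?_ ?_ | refine .bex_le ?_ ?_
  · repeat' first
      | exact .var _ | exact .const _ | refine .pair ?_ ?_ | refine .memCode ?_ ?_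
      | refine .isRun hS ?_ ?_ | refine .eq ?_ ?_ | refine .and ?_ ?_ | refine .bex_le ?_ ?_
      | refine .ball ?_ ?_ | refine .imp ?_ ?_
  · intro e
    constructor
    · rintro ⟨s, n, hn, y, hy, rfl, hs, hys⟩ s'
      exact ⟨n, hn, y, hy, rfl, fun hs' z _ hz =>
        (huniq hs' le_rfl hz).trans (huniq hs le_rfl hys).symm⟩
    · intro h
      -- The instance 0 only decodes `e`; the instance `g n`, a genuine run, then identifies `y`.
      obtain ⟨n, hn, y, hy, rfl, -⟩ := h 0
      obtain ⟨n', -, y', -, he, h'⟩ := h (g n)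
      obtain ⟨rfl, rfl⟩ := pair_inj.1 he
      refine ⟨g n, n, hn, y, hy, rfl, hg n, ?_⟩
      rw [← h' (hg n) (f n) (hf n).right_lt (hf n)]
      exact hf n
  · constructor
    · rintro ⟨s, n', -, y', -, he, hs, hys⟩
      obtain ⟨rfl, rfl⟩ := pair_inj.1 he
      exact huniq hs le_rfl hys
    · rintro rfl
      exact ⟨g n, n, left_le_pair _ _, f n, right_le_pair _ _, rfl, hg n, hf n⟩
  · exact (hg 0).2.1 _ (hf 0).right_lt (hf 0)
  · have hn : n < n + 1 := lt_add_one_iff'.2 le_rfl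
    obtain ⟨y, hy, hys⟩ := (hg (n + 1)).1 n hn.le
    obtain rfl := huniq (hg (n + 1)) hn.le hys
    exact ((hg (n + 1)).2.2 n hn _ hy _ (hf (n + 1)).right_lt hys (hf (n + 1))).1

end recursion

/-! ## Uniqueness of the random graph -/

namespace Graph

/-- `p` codes a finite partial isomorphism from `G` to `H`. -/
def PartialIso (G H : M.Graph) (p : M.Carrier) : Prop :=
  (∀ x y, MemCode (pair x y) p → x ∈ G.V ∧ y ∈ H.V) ∧
  ∀ x y x' y', MemCode (pair x y) p → MemCode (pair x' y') p →
    (x = x' ↔ y = y') ∧ (pair x x' ∈ G.E ↔ pair y y' ∈ H.E)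

theorem delta0_partialIso (G H : M.Graph) {t : (ℕ → M.Carrier) → M.Carrier} (ht : IsTerm t) :
    Delta0 fun v => G.PartialIso H (t v) := by
  refine Delta0.subst₁ ?_ ht
  have h : Delta0 fun v : ℕ → M.Carrier =>
      (∀ x, x < v 0 → ∀ y, y < v 0 → MemCode (pair x y) (v 0) → x ∈ G.V ∧ y ∈ H.V) ∧
      ∀ x, x < v 0 → ∀ y, y < v 0 → ∀ x', x' < v 0 → ∀ y', y' < v 0 →
        MemCode (pair x y) (v 0) → MemCode (pair x' y') (v 0) →
          (x = x' ↔ y = y') ∧ (pair x x' ∈ G.E ↔ pair y y' ∈ H.E) := by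
    repeat' first
      | exact .var _ | refine .pair ?_ ?_ | refine .memCode ?_ ?_ | refine .mem G.V_mem ?_
      | refine .mem H.V_mem ?_ | refine .mem G.E_mem ?_ | refine .mem H.E_mem ?_
      | refine .eq ?_ ?_ | refine .and ?_ ?_ | refine .ball ?_ ?_ | refine .iff ?_ ?_
      | refine .imp ?_ ?_
  refine h.congr fun v => ⟨fun h => ⟨fun x _ y _ => h.1 x y,
    fun x _ y _ x' _ y' _ => h.2 x y x' y'⟩, fun h => ⟨fun x y hm => ?_,
    fun x y x' y' hm hm' => ?_⟩⟩
  · exact h.1 x hm.left_lt y hm.right_lt hm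
  · exact h.2 x hm.left_lt y hm.right_lt x' hm'.left_lt y' hm'.right_lt hm hm'

/-- Reduces the back step to the forth step. -/
theorem PartialIso.exists_inverse {G H : M.Graph} {p : M.Carrier} (hp : G.PartialIso H p) :
    ∃ q, H.PartialIso G q ∧ ∀ x y, MemCode (pair y x) q ↔ MemCode (pair x y) p := by
  obtain ⟨q, hq⟩ := exists_rel_code (R := fun y x => MemCode (pair x y) p)
    (.memCode (.pair (.var 1) (.var 0)) (.const p)) p p
  have hq' : ∀ x y, MemCode (pair y x) q ↔ MemCode (pair x y) p := fun x y =>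
    (hq y x).trans ⟨fun h => h.2.2, fun h => ⟨h.right_lt, h.left_lt, h⟩⟩
  refine ⟨q, ⟨fun y x h => (hp.1 x y ((hq' x y).1 h)).symm, fun y x y' x' h h' => ?_⟩, hq'⟩
  have := hp.2 x y x' y' ((hq' x y).1 h) ((hq' x' y').1 h')
  exact ⟨this.1.symm, this.2.symm⟩

/-- The image `j` of a new vertex `i` comes from the extension property in `H`, for the images of
the neighbours and of the non-neighbours of `i` in the domain of `p`. These are disjoint because `p`
is injective. -/
theorem PartialIso.extend {G H : M.Graph} (hH : H.IsRandom) {p : M.Carrier}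
    (hp : G.PartialIso H p) {i : M.Carrier} (hi : i ∈ G.V) : ∃ q, G.PartialIso H q ∧
      (∀ x y, MemCode (pair x y) p → MemCode (pair x y) q) ∧ ∃ y, MemCode (pair i y) q := by
  by_cases hdom : ∃ y, MemCode (pair i y) p
  · exact ⟨p, hp, fun _ _ h => h, hdom⟩
  push Not at hdom
  have hA : {y | ∃ x, x < p ∧ MemCode (pair x y) p ∧ pair i x ∈ G.E} ∈ M.sets := by
    refine setOf_mem_sets ?_
    repeat' first
      | exact .var _ | exact .const _ | refine .pair ?_ ?_ | refine .memCode ?_ ?_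
      | refine .mem G.E_mem ?_ | refine .and ?_ ?_ | refine .bex ?_ ?_
  have hB : {y | ∃ x, x < p ∧ MemCode (pair x y) p ∧ ¬ pair i x ∈ G.E} ∈ M.sets := by
    refine setOf_mem_sets ?_
    repeat' first
      | exact .var _ | exact .const _ | refine .pair ?_ ?_ | refine .memCode ?_ ?_
      | refine .mem G.E_mem ?_ | refine .not ?_ | refine .and ?_ ?_ | refine .bex ?_ ?_
  obtain ⟨j, hjV, hj, hjA, hjB⟩ := hH _ hA _ hB ⟨p, fun y ⟨x, _, h, _⟩ => h.right_lt⟩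
    ⟨p, fun y ⟨x, _, h, _⟩ => h.right_lt⟩ (fun y ⟨x, _, h, _⟩ => (hp.1 x y h).2)
    (fun y ⟨x, _, h, _⟩ => (hp.1 x y h).2) (by
      refine Set.disjoint_left.2 ?_
      rintro y ⟨x, -, h, hx⟩ ⟨x', -, h', hx'⟩
      rw [((hp.2 x y x' y h h').1).2 rfl] at hx
      exact hx' hx)
  have hedge : ∀ x y, MemCode (pair x y) p → (pair i x ∈ G.E ↔ pair j y ∈ H.E) := by
    intro x y h
    by_cases hx : pair i x ∈ G.E
    · exact iff_of_true hx (hjA y ⟨x, h.left_lt, h, hx⟩)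
    · exact iff_of_false hx (hjB y ⟨x, h.left_lt, h, hx⟩)
  have hran : ∀ x y, MemCode (pair x y) p → j ≠ y := by
    rintro x y h rfl
    by_cases hx : pair i x ∈ G.E
    · exact hj (Or.inl ⟨x, h.left_lt, h, hx⟩)
    · exact hj (Or.inr ⟨x, h.left_lt, h, hx⟩)
  have hdom' : ∀ x y, MemCode (pair x y) p → i ≠ x := by
    rintro x y h rfl
    exact hdom y h
  have hR : Delta0 fun v : ℕ → M.Carrier =>
      MemCode (pair (v 0) (v 1)) p ∨ v 0 = i ∧ v 1 = j := by
    repeat' first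
      | exact .var _ | exact .const _ | refine .pair ?_ ?_ | refine .memCode ?_ ?_
      | refine .eq ?_ ?_ | refine .and ?_ ?_ | refine .or ?_ ?_
  obtain ⟨q, hq⟩ := exists_rel_code (R := fun x y => MemCode (pair x y) p ∨ x = i ∧ y = j) hR
    (p + i + 1) (p + j + 1)
  have hq' : ∀ x y, MemCode (pair x y) q ↔ MemCode (pair x y) p ∨ x = i ∧ y = j := by
    intro x y
    rw [hq]
    refine ⟨fun h => h.2.2, fun h => ⟨?_, ?_, h⟩⟩
    · rcases h with h | ⟨rfl, -⟩
      · exact lt_add_one_iff'.2 (h.left_lt.le.trans le_self_add)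
      · exact lt_add_one_iff'.2 le_add_self
    · rcases h with h | ⟨-, rfl⟩
      · exact lt_add_one_iff'.2 (h.right_lt.le.trans le_self_add)
      · exact lt_add_one_iff'.2 le_add_self
  refine ⟨q, ⟨fun x y h => ?_, fun x y x' y' h h' => ?_⟩, fun x y h => (hq' x y).2 (Or.inl h),
    j, (hq' i j).2 (Or.inr ⟨rfl, rfl⟩)⟩
  · rcases (hq' x y).1 h with h | ⟨rfl, rfl⟩
    exacts [hp.1 x y h, ⟨hi, hjV⟩]
  · rcases (hq' x y).1 h with h | ⟨rfl, rfl⟩ <;> rcases (hq' x' y').1 h' with h' | ⟨rfl, rfl⟩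
    · exact hp.2 x y x' y' h h'
    · refine ⟨iff_of_false (hdom' x y h).symm (hran x y h).symm, ?_⟩
      rw [G.E_comm, H.E_comm]
      exact hedge x y h
    · exact ⟨iff_of_false (hdom' x' y' h') (hran x' y' h'), hedge x' y' h'⟩
    · exact ⟨iff_of_true rfl rfl, iff_of_false (G.irrefl _) (H.irrefl _)⟩

/-- The step of the back-and-forth construction. -/
def BackAndForth (G H : M.Graph) (n p q : M.Carrier) : Prop :=
  G.PartialIso H p → G.PartialIso H q ∧
    (∀ x, x < p → ∀ y, y < p → MemCode (pair x y) p → MemCode (pair x y) q) ∧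
    (n ∈ G.V → ∃ y, y < q ∧ MemCode (pair n y) q) ∧ (n ∈ H.V → ∃ x, x < q ∧ MemCode (pair x n) q)

theorem exists_backAndForth {G H : M.Graph} (hG : G.IsRandom) (hH : H.IsRandom)
    (n p : M.Carrier) : ∃ q, G.BackAndForth H n p q := by
  -- Recursion needs a relation that is total on all numbers; for a `p` that is no partial
  -- isomorphism it holds vacuously, and 0 serves as default.
  by_cases hp : G.PartialIso H p
  swap
  · exact ⟨0, fun h => (hp h).elim⟩
  have forth : ∃ q, G.PartialIso H q ∧ (∀ x y, MemCode (pair x y) p → MemCode (pair x y) q) ∧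
      (n ∈ G.V → ∃ y, MemCode (pair n y) q) := by
    by_cases hn : n ∈ G.V
    · obtain ⟨q, hq, hpq, h⟩ := hp.extend hH hn
      exact ⟨q, hq, hpq, fun _ => h⟩
    · exact ⟨p, hp, fun _ _ h => h, fun h => (hn h).elim⟩
  obtain ⟨q, hq, hpq, hqn⟩ := forth
  have back : ∃ r, G.PartialIso H r ∧ (∀ x y, MemCode (pair x y) q → MemCode (pair x y) r) ∧
      (n ∈ H.V → ∃ x, MemCode (pair x n) r) := by
    by_cases hn : n ∈ H.V
    · obtain ⟨q', hq', hqq'⟩ := hq.exists_inverse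
      obtain ⟨r', hr', hqr', x, hx⟩ := hq'.extend hG hn
      obtain ⟨r, hr, hrr'⟩ := hr'.exists_inverse
      exact ⟨r, hr, fun x y h => (hrr' y x).2 (hqr' y x ((hqq' x y).2 h)),
        fun _ => ⟨x, (hrr' n x).2 hx⟩⟩
    · exact ⟨q, hq, fun _ _ h => h, fun h => (hn h).elim⟩
  obtain ⟨r, hr, hqr, hrn⟩ := back
  refine ⟨r, fun _ => ⟨hr, fun x _ y _ h => hqr x y (hpq x y h), fun hn => ?_, fun hn => ?_⟩⟩
  · obtain ⟨y, hy⟩ := hqn hn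
    exact ⟨y, (hqr n y hy).right_lt, hqr n y hy⟩
  · obtain ⟨x, hx⟩ := hrn hn
    exact ⟨x, hx.left_lt, hx⟩

theorem IsRandom.iso {G H : M.Graph} (hG : G.IsRandom) (hH : H.IsRandom) : G.Iso H := by
  have hS : Delta0 fun v : ℕ → M.Carrier => G.BackAndForth H (v 0) (v 1) (v 2) := by
    unfold BackAndForth
    repeat' first
      | exact .var _ | refine .pair ?_ ?_ | refine .memCode ?_ ?_ | refine .mem G.V_mem ?_
      | refine .mem H.V_mem ?_ | refine delta0_partialIso G H ?_ | refine .and ?_ ?_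
      | refine .bex ?_ ?_ | refine .ball ?_ ?_ | refine .imp ?_ ?_
  obtain ⟨p, -, hp⟩ := exists_code (P := fun _ : M.Carrier => False) (.const False) 0 0
  have hp0 : ∀ u, ¬ MemCode u p := fun u h => ((hp u).1 h).2
  obtain ⟨f, F, hF, hFf, hf0, hstep⟩ := exists_path hS (exists_backAndForth hG hH) p
  have hpi : ∀ n, G.PartialIso H (f n) := by
    intro n
    -- The function `f` is not a term, so statements about its values quantify over all `y` with
    -- `pair n y ∈ F`, which is Π⁰₁.
    refine pi1_induction (Q := fun y n => pair n y ∈ F → G.PartialIso H y) ?_ ?_ ?_ n (f n)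
      ((hFf _ _).2 rfl)
    · exact .imp (.mem hF (.pair (.var 1) (.var 0))) (delta0_partialIso G H (.var 0))
    · intro y hy
      rw [(hFf _ _).1 hy, hf0]
      exact ⟨fun x y h => (hp0 _ h).elim, fun x y x' y' h => (hp0 _ h).elim⟩
    · intro n ih y hy
      rw [(hFf _ _).1 hy]
      exact (hstep n (ih (f n) ((hFf _ _).2 rfl))).1
  have hsucc : ∀ n u v, MemCode (pair u v) (f n) → MemCode (pair u v) (f (n + 1)) :=
    fun n u v h => (hstep n (hpi n)).2.1 u h.left_lt v h.right_lt h
  have hmono : ∀ m n, m ≤ n → ∀ u v, MemCode (pair u v) (f m) → MemCode (pair u v) (f n) := by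
    intro m n hmn u v h
    refine pi1_induction (Q := fun y n => m ≤ n → pair n y ∈ F → MemCode (pair u v) y) ?_ ?_ ?_
      n (f n) hmn ((hFf _ _).2 rfl)
    · repeat' first
        | exact .var _ | exact .const _ | refine .pair ?_ ?_ | refine .memCode ?_ ?_
        | refine .mem hF ?_ | refine .le ?_ ?_ | refine .imp ?_ ?_
    · intro y hm hy
      rw [(hFf _ _).1 hy, ← le_antisymm hm (zero_le' m)]
      exact h
    · intro n ih y hm hy
      rw [(hFf _ _).1 hy]
      rcases hm.eq_or_lt with rfl | hm
      · exact h
      · exact hsucc n u v (ih (f n) (lt_add_one_iff'.1 hm) ((hFf _ _).2 rfl))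
  have hcommon : ∀ {x y x' y' m n}, MemCode (pair x y) (f m) → MemCode (pair x' y') (f n) →
      (x = x' ↔ y = y') ∧ (pair x x' ∈ G.E ↔ pair y y' ∈ H.E) := fun {x y x' y' m n} h h' =>
    (hpi (m + n)).2 x y x' y' (hmono m _ le_self_add _ _ h) (hmono n _ le_add_self _ _ h')
  have hforth : ∀ x, x ∈ G.V → ∃ y, MemCode (pair x y) (f (x + 1)) := by
    intro x hx
    obtain ⟨y, -, hy⟩ := (hstep x (hpi x)).2.2.1 hx
    exact ⟨y, hy⟩
  have hback : ∀ y, y ∈ H.V → ∃ x, MemCode (pair x y) (f (y + 1)) := by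
    intro y hy
    obtain ⟨x, -, hx⟩ := (hstep y (hpi y)).2.2.2 hy
    exact ⟨x, hx⟩
  have hlt : ∀ x : M.Carrier, x < x + 1 := fun x => lt_add_one_iff'.2 le_rfl
  -- The union of the stages is Δ⁰₁: a vertex `x` receives its image by stage `x + 1`, and `x ≤ e`
  -- for `e = pair x y`, so membership of `e` is settled at every stage beyond `e`.
  have hI : {e | ∃ t, ∃ n, n ≤ t ∧ ∃ q, q ≤ t ∧ ∃ x, x ≤ e ∧ ∃ y, y ≤ e ∧ pair n q ∈ F ∧
      e = pair x y ∧ MemCode (pair x y) q} ∈ M.sets := by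
    refine setOf_exists_mem_sets (Q' := fun t e => ∃ x, x ≤ e ∧ ∃ y, y ≤ e ∧ e = pair x y ∧
      ∀ n, n ≤ t → ∀ q, q ≤ t → e < n → pair n q ∈ F → MemCode (pair x y) q) ?_ ?_ fun e => ?_
    · repeat' first
        | exact .var _ | refine .pair ?_ ?_ | refine .memCode ?_ ?_ | refine .mem hF ?_
        | refine .eq ?_ ?_ | refine .and ?_ ?_ | refine .bex_le ?_ ?_
    · repeat' first
        | exact .var _ | refine .pair ?_ ?_ | refine .memCode ?_ ?_ | refine .mem hF ?_
        | refine .eq ?_ ?_ | refine .lt ?_ ?_ | refine .and ?_ ?_ | refine .bex_le ?_ ?_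
        | refine .ball_le ?_ ?_ | refine .imp ?_ ?_
    · constructor
      · rintro ⟨-, n, -, q, -, x, hx, y, hy, hnq, rfl, hm⟩ t
        refine ⟨x, hx, y, hy, rfl, fun m _ r _ hlt' hmr => ?_⟩
        obtain rfl := (hFf _ _).1 hnq
        obtain rfl := (hFf _ _).1 hmr
        obtain ⟨z, hz⟩ := hforth x ((hpi n).1 x y hm).1
        rw [(hcommon hm hz).1.1 rfl]
        exact hmono _ m (add_one_le_iff'.2 (hx.trans_lt hlt')) x z hz
      · intro h
        -- This bound is large enough to see both the stage number `e + 1` and its value.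
        obtain ⟨x, hx, y, hy, he, h⟩ := h (e + 1 + f (e + 1))
        exact ⟨e + 1 + f (e + 1), e + 1, le_self_add, f (e + 1), le_add_self, x, hx, y, hy,
          (hFf _ _).2 rfl, he, h (e + 1) le_self_add _ le_add_self (hlt e) ((hFf _ _).2 rfl)⟩
  refine ⟨_, hI, ?_⟩
  have hmem : ∀ x y, pair x y ∈ {e | ∃ t, ∃ n, n ≤ t ∧ ∃ q, q ≤ t ∧ ∃ x, x ≤ e ∧ ∃ y, y ≤ e ∧
      pair n q ∈ F ∧ e = pair x y ∧ MemCode (pair x y) q} ↔ ∃ n, MemCode (pair x y) (f n) := by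
    intro x y
    constructor
    · rintro ⟨-, n, -, q, -, x', -, y', -, hnq, he, hm⟩
      obtain ⟨rfl, rfl⟩ := pair_inj.1 he
      exact ⟨n, (hFf _ _).1 hnq ▸ hm⟩
    · rintro ⟨n, hn⟩
      exact ⟨n + f n, n, le_self_add, f n, le_add_self, x, left_le_pair _ _, y,
        right_le_pair _ _, (hFf _ _).2 rfl, rfl, hn⟩
  refine ⟨⟨?_, fun x hx => ?_, fun y hy => ?_⟩, fun x x' y y' h h' => ?_⟩
  · rintro _ ⟨-, n, -, q, -, x, -, y, -, hnq, rfl, hm⟩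
    obtain rfl := (hFf _ _).1 hnq
    exact ⟨x, ((hpi n).1 x y hm).1, y, ((hpi n).1 x y hm).2, rfl⟩
  · obtain ⟨y, hy⟩ := hforth x hx
    refine ⟨y, (hmem _ _).2 ⟨_, hy⟩, fun y' hy' => ?_⟩
    obtain ⟨n, hn⟩ := (hmem _ _).1 hy'
    exact (hcommon hn hy).1.1 rfl
  · obtain ⟨x, hx⟩ := hback y hy
    refine ⟨x, (hmem _ _).2 ⟨_, hx⟩, fun x' hx' => ?_⟩
    obtain ⟨n, hn⟩ := (hmem _ _).1 hx'
    exact (hcommon hn hx).1.2 rfl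
  · obtain ⟨n, hn⟩ := (hmem _ _).1 h
    obtain ⟨n', hn'⟩ := (hmem _ _).1 h'
    exact (hcommon hn hn').2

end Graph

/-- Uniqueness of the random graph supplies some failing size; the Σ⁰₂ form of failure then lets the
least number principle apply. -/
theorem LeastSigma2.leastExtensionFailure (h : M.LeastSigma2) : M.LeastExtensionFailure :=
  fun _ hR G hG => h _ G.isSigma2_extensionFails
    (Graph.exists_extensionFails fun hGr => hG (hGr.iso hR))

end Structure2

end SecondOrderArith

/-- Over `RCA₀`, that is, in every model of `RCA₀`, the existence of a least size of a failure of
the extension property in every graph not isomorphic to the random graph is equivalent to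
`LΣ⁰₂`. -/
theorem theorem5p1 (M : SecondOrderArith.Structure2.{u}) (hM : M.ModelsRCA0) :
    M.LeastExtensionFailure ↔ M.LeastSigma2 := by
  have : Fact M.ModelsRCA0 := ⟨hM⟩
  exact ⟨fun h => h.leastSigma2, fun h => h.leastExtensionFailure⟩
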